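/- For graphs $G_1,G_2$ let $R(G_1,G_2)$ be the least integer $r$ such that every graph $G$ on $r$ vertices contains $G_1$ as a (not necessarily induced) subgraph or its complement $\overline{G}$ contains $G_2$ as a subgraph. Let $P_n$ be the path on $n$ vertices, and let $K_1\vee F$ be the graph obtained from $F$ by adding one new vertex adjacent to every vertex of $F$. A linear forest is a forest each component of which is a path (a single vertex counts as a path). Let $n\ge 2$ and $n+1\le m\le 2n-1$, and let $F$ be a linear forest on $m$ vertices with at least one edge. Let $o(F)$ be the number of components of $F$ that have an odd number of vertices, and let $\mathrm{pa}(m)\in\{0,1\}$ be the parity of $m$, that is, the remainder of $m$ on division by $2$. Then (1) $R(P_n,K_1\vee F)\le m+n-2+\mathrm{pa}(m)$, and (2) $R(P_n,K_1\vee F)\ge\max\{2n-1,\ \lceil 3m/2\rceil-1,\ m+n-o(F)-2\}$. -/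

import Mathlib

/-- The join `G ∨ H`: the disjoint union of `G` and `H`, with every vertex of `G` made adjacent
to every vertex of `H`. -/
def graphJoin {V W : Type*} (G : SimpleGraph V) (H : SimpleGraph W) : SimpleGraph (V ⊕ W) where
  Adj
    | Sum.inl u, Sum.inl v => G.Adj u v
    | Sum.inr u, Sum.inr v => H.Adj u v
    | Sum.inl _, Sum.inr _ => True
    | Sum.inr _, Sum.inl _ => True
  symm := ⟨by
    rintro (u | u) (v | v) h
    · exact G.adj_symm h
    · trivial
    · trivial
    · exact H.adj_symm h⟩
  loopless := ⟨by
    rintro (u | u) h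
    · exact G.irrefl h
    · exact H.irrefl h⟩

/-- A linear forest: a forest each component of which is a path (on one or more vertices). -/
def IsLinearForest {V : Type*} (F : SimpleGraph V) : Prop :=
  F.IsAcyclic ∧
    ∀ c : F.ConnectedComponent, ∃ k : ℕ, Nonempty (c.toSimpleGraph ≃g SimpleGraph.pathGraph k)

/-- Every graph on `r` vertices contains `G₁`, or its complement contains `G₂`
(as a not necessarily induced subgraph). -/
def RamseyProperty {V W : Type*} (G₁ : SimpleGraph V) (G₂ : SimpleGraph W) (r : ℕ) : Prop :=
  ∀ G : SimpleGraph (Fin r), G₁.IsContained G ∨ G₂.IsContained Gᶜ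

/-- The Ramsey number `R(G₁, G₂)`: the least `r` such that `RamseyProperty G₁ G₂ r` holds.
It is meaningful when there is such an `r`. -/
noncomputable def ramseyNumber {V W : Type*} (G₁ : SimpleGraph V) (G₂ : SimpleGraph W) : ℕ :=
  sInf {r : ℕ | RamseyProperty G₁ G₂ r}

/-- The graph `K₁ ∨ F`: a single vertex joined to every vertex of `F`. -/
def coneGraph {V : Type*} (F : SimpleGraph V) : SimpleGraph (Fin 1 ⊕ V) :=
  graphJoin (⊤ : SimpleGraph (Fin 1)) F

/-!
Throughout, a graph `G` and its complement are a red-blue colouring of a complete graph, and a path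
is a list of distinct vertices with consecutive ones adjacent.

**Upper bound.** Let `G` have `m + n - 2 + m % 2` vertices and no red path on `n` vertices. Since a
linear forest on `m` vertices lies in the path on `m` vertices
(`IsLinearForest.exists_bijection`), it is enough to find a vertex `x` whose blue neighbourhood `X`
contains a blue path on `m` vertices.

The main tool is the following. Let `P` be a longest blue path in `X`, and let `R` be a set of
vertices of `X` outside `P`. As no vertex of `R` can be inserted into `P`, each of them is joined in
red to both ends of `P` and to one of any two consecutive vertices of `P`. Cut the interior of `P`
into pairs. Among any three vertices of `R`, two have a common red neighbour in a given pair, so the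
vertices of `R` can be linked, one pair at a time, into two red paths (`exists_two_paths`), which an
end of `P` joins into one (`exists_alternating_path`). If `2 * |R| ≤ |P|`, this gives a red path on
`2 * |R| + 1` vertices (`IsLongestPathIn.exists_path_odd`).

If some red component has at least `n` vertices, Ore's argument yields a vertex `x` in it of red
degree at most `(n - 2) / 2` (`exists_two_mul_degree_add_two_le`). Counting then contradicts the
absence of a red path on `n` vertices, except when `m` and `n` are even and `|R| = n / 2 - 1`, where
the path has only `n - 1` vertices. If `R` meets the component of `x`, a red path from `x` to `R` is
put in front of the alternating path. Otherwise the non-neighbours of `x` in its component lie on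
`P` and are blue to all of `R`, and by rotating `P` their successors turn out to form a red clique
which is completely red to `R` (`IsLongestPathIn.exists_path_of_universal`). Either way a red path
on `n` vertices appears. If all red components are small, `x` is taken in a smallest one, and the
blue graph on the other components contains a complete multipartite graph with a long path
(`exists_compl_path_of_small_components`).

**Lower bound.** The red graphs are disjoint unions of at most three cliques with at most `n - 1`
vertices (`sum_lt_of_ramseyProperty`). For sizes `n - 1, n - 1` and `⌊m/2⌋, ⌊(m-1)/2⌋, ⌊(m-1)/2⌋`
all blue degrees are less than `m`. For sizes `n - 1, q, q` with `q = (m - o(F)) / 2 - 1`, a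
copy of `K₁ ∨ F` would need its centre in a clique of size `q`. Then the vertices of `F` in the other
clique of size `q` would form a vertex cover of `F`, which is impossible, since a vertex cover of a
linear forest has at least `(m - o(F)) / 2` vertices (`IsLinearForest.card_le_of_cover`).
-/

open SimpleGraph

/-! ### Paths as lists, and alternating paths -/

section Paths

variable {V : Type*}

/-- `l` lists, in order, the vertices of a path of `G` all of whose vertices lie in `X`. -/
structure IsPathIn (G : SimpleGraph V) (X : Finset V) (l : List V) : Prop where
  nodup : l.Nodup
  chain : l.IsChain G.Adj
  mem : ∀ v ∈ l, v ∈ X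

/-- `l` is a path of `G` inside `X` with the largest possible number of vertices. -/
structure IsLongestPathIn (G : SimpleGraph V) (X : Finset V) (l : List V) : Prop
    extends IsPathIn G X l where
  length_le : ∀ l', IsPathIn G X l' → l'.length ≤ l.length

theorem IsPathIn.mono {G : SimpleGraph V} {X Y : Finset V} {l : List V} (h : IsPathIn G X l)
    (hXY : X ⊆ Y) : IsPathIn G Y l :=
  ⟨h.nodup, h.chain, fun v hv => hXY (h.mem v hv)⟩

theorem IsPathIn.length_le_card {G : SimpleGraph V} {X : Finset V} {l : List V}
    (h : IsPathIn G X l) : l.length ≤ X.card := by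
  classical
  rw [← List.toFinset_card_of_nodup h.nodup]
  exact Finset.card_le_card fun v hv => h.mem v (by simpa using hv)

theorem exists_isLongestPathIn (G : SimpleGraph V) (X : Finset V) :
    ∃ l, IsLongestPathIn G X l := by
  classical
  let P : ℕ → Prop := fun k => ∃ l, IsPathIn G X l ∧ l.length = k
  have h0 : P 0 := ⟨[], ⟨by simp, by simp, by simp⟩, rfl⟩
  obtain ⟨l, hl, hlen⟩ := Nat.findGreatest_spec (Nat.zero_le X.card) h0
  exact ⟨l, hl, fun l' hl' => hlen ▸ Nat.le_findGreatest hl'.length_le_card ⟨l', hl', rfl⟩⟩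

theorem isChain_adj_reverse {G : SimpleGraph V} {l : List V} (h : l.IsChain G.Adj) :
    l.reverse.IsChain G.Adj := by
  rw [List.isChain_reverse]
  exact h.imp fun _ _ => G.adj_symm

/-- A vertex outside a longest path cannot be inserted between two consecutive parts of it
(either of which may be empty). -/
theorem IsLongestPathIn.not_insert {G : SimpleGraph V} {X : Finset V} {A C : List V}
    (h : IsLongestPathIn G X (A ++ C)) {r : V} (hr : r ∈ X) (hr' : r ∉ A ++ C)
    (hA : ∀ a ∈ A.getLast?, G.Adj a r) (hC : ∀ c ∈ C.head?, G.Adj r c) : False := by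
  have hp : (A ++ r :: C).Perm (r :: (A ++ C)) := List.perm_middle
  have hch := List.isChain_append.1 h.chain
  have := h.length_le (A ++ r :: C) ⟨hp.nodup_iff.2 (List.nodup_cons.2 ⟨hr', h.nodup⟩), by
    refine hch.1.append (hch.2.1.cons hC) ?_
    simpa using hA, by
    intro v hv
    rcases List.mem_cons.1 (hp.mem_iff.1 hv) with rfl | hv
    exacts [hr, h.mem v hv]⟩
  simp at this

/-- The rotation of a longest path `A ++ B ++ C`: reversing `B` and putting a new vertex between
`A` and the reversed `B` cannot give a path. -/
theorem IsLongestPathIn.not_rotate {G : SimpleGraph V} {X : Finset V} {A B C : List V}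
    (h : IsLongestPathIn G X (A ++ (B ++ C))) {r : V} (hr : r ∈ X) (hr' : r ∉ A ++ (B ++ C))
    (hB : B ≠ []) (hA : ∀ a ∈ A.getLast?, G.Adj a r) (hrB : ∀ b ∈ B.getLast?, G.Adj r b)
    (hBC : ∀ b ∈ B.head?, ∀ c ∈ C.head?, G.Adj b c) : False := by
  have hp : (A ++ r :: (B.reverse ++ C)).Perm (r :: (A ++ (B ++ C))) :=
    List.perm_middle.trans (((B.reverse_perm.append_right C).append_left A).cons r)
  have hch := List.isChain_append.1 h.chain
  have hch' := List.isChain_append.1 hch.2.1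
  have := h.length_le (A ++ r :: (B.reverse ++ C))
    ⟨hp.nodup_iff.2 (List.nodup_cons.2 ⟨hr', h.nodup⟩), by
    refine hch.1.append
      (List.IsChain.cons ((isChain_adj_reverse hch'.1).append hch'.2.1 ?_) ?_) ?_
    · simpa using hBC
    · intro y hy
      rw [List.head?_append_of_ne_nil _ (by simpa using hB), List.head?_reverse] at hy
      exact hrB y hy
    · simpa using hA, by
    intro v hv
    rcases List.mem_cons.1 (hp.mem_iff.1 hv) with rfl | hv
    exacts [hr, h.mem v hv]⟩
  simp at this

/-- `pairUp [a, b, c, d, …] = [(a, b), (c, d), …]`, dropping the last entry of a list of odd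
length. -/
def pairUp : List V → List (V × V)
  | a :: b :: l => (a, b) :: pairUp l
  | _ => []

/-- The list of all entries of a list of pairs. -/
abbrev unpair (Q : List (V × V)) : List V := Q.flatMap fun q => [q.1, q.2]

theorem length_pairUp : ∀ l : List V, (pairUp l).length = l.length / 2
  | [] => by simp [pairUp]
  | [_] => by simp [pairUp]
  | a :: b :: l => by simp [pairUp, length_pairUp l]; omega

theorem unpair_pairUp_sublist : ∀ l : List V, (unpair (pairUp l)).Sublist l
  | [] => by simp [pairUp]
  | [_] => by simp [pairUp]
  | a :: b :: l => by simpa [pairUp] using unpair_pairUp_sublist l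

theorem rel_of_mem_pairUp {r : V → V → Prop} :
    ∀ {l : List V}, l.IsChain r → ∀ q ∈ pairUp l, r q.1 q.2
  | [], _ => by simp [pairUp]
  | [_], _ => by simp [pairUp]
  | a :: b :: l, h => by
    rw [List.isChain_cons_cons] at h
    intro q hq
    rcases List.mem_cons.1 hq with rfl | hq
    · exact h.1
    · exact rel_of_mem_pairUp h.2.tail q hq

/-- Linking step behind `exists_alternating_path`. If every vertex of `a :: b :: rs` is adjacent
to an entry of every pair in `Q`, and there are enough pairs, then the vertices of `a :: b :: rs`
can be covered by two alternating paths. The invariant works because of three ends (those of the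
two paths and a new vertex) two are adjacent to the same entry of the next pair. -/
theorem exists_two_paths (G : SimpleGraph V) (a b : V) : ∀ (rs : List V) (Q : List (V × V)),
    rs.length ≤ Q.length → (a :: b :: rs ++ unpair Q).Nodup →
    (∀ q ∈ Q, ∀ r ∈ a :: b :: rs, G.Adj q.1 r ∨ G.Adj q.2 r) →
    ∃ x A y B b', (x :: A).getLast? = some a ∧ (y :: B).getLast? = some b' ∧
      x ∈ a :: b :: rs ∧ y ∈ a :: b :: rs ∧ b' ∈ a :: b :: rs ∧
      (x :: A).IsChain G.Adj ∧ (y :: B).IsChain G.Adj ∧ (x :: A ++ y :: B).Nodup ∧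
      (x :: A ++ y :: B).length = 2 * rs.length + 2 ∧
      ∀ v ∈ x :: A ++ y :: B, v ∈ a :: b :: rs ∨
        (v ∈ unpair Q ∧ ∃ r ∈ a :: b :: rs, G.Adj v r)
  | [], Q, _, hnd, _ => by
    refine ⟨a, [], b, [], b, by simp, by simp, by simp, by simp, by simp, by simp, by simp, ?_,
      by simp, by simp +contextual⟩
    exact (hnd.sublist (List.sublist_append_left _ _))
  | r :: rs, [], h, _, _ => by simp at h
  | r :: rs, q :: Q, hl, hnd, hQ => by
    have hperm : (a :: b :: r :: rs ++ unpair (q :: Q)).Perm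
        ([r, q.1, q.2] ++ (a :: b :: rs ++ unpair Q)) := by
      classical
      rw [List.perm_iff_count]
      intro v
      simp [List.count_cons]
      ring
    rw [hperm.nodup_iff, List.nodup_append'] at hnd
    obtain ⟨hnd3, hnd', hdisj⟩ := hnd
    obtain ⟨x, A, y, B, b', hxa, hyb, hx, hy, hb', hA, hB, hAB, hlen, hmem⟩ :=
      exists_two_paths G a b rs Q (by simpa using hl) hnd'
        (fun q' hq' r' hr' => hQ q' (List.mem_cons_of_mem _ hq') r' (by simp at hr' ⊢; tauto))
    have hsub : ∀ v ∈ a :: b :: rs, v ∈ a :: b :: r :: rs := by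
      intro v hv; simp at hv ⊢; tauto
    have hold : ∀ v ∈ x :: A ++ y :: B, v ∈ a :: b :: rs ++ unpair Q := by
      intro v hv
      rcases hmem v hv with h | h
      · exact List.mem_append_left _ h
      · exact List.mem_append_right _ h.1
    have hnew : ∀ z ∈ [r, q.1, q.2], z ∉ x :: A ++ y :: B := fun z hz hz' => hdisj hz (hold z hz')
    have hmem' : ∀ v ∈ x :: A ++ y :: B, v ∈ a :: b :: r :: rs ∨
        (v ∈ unpair (q :: Q) ∧ ∃ r' ∈ a :: b :: r :: rs, G.Adj v r') := by
      intro v hv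
      rcases hmem v hv with h | ⟨h, r', hr', h'⟩
      · exact Or.inl (hsub v h)
      · exact Or.inr ⟨by rw [unpair, List.flatMap_cons]; exact List.mem_append_right _ h,
          r', hsub _ hr', h'⟩
    -- two of the three active ends `x`, `y`, `r` share a neighbour `p` in the pair `q`
    have key : ∃ p, (p = q.1 ∨ p = q.2) ∧ ((G.Adj p r ∧ G.Adj p x) ∨ (G.Adj p r ∧ G.Adj p y) ∨
        (G.Adj p x ∧ G.Adj p y)) := by
      have h1 := hQ q (by simp) r (by simp)
      have h2 := hQ q (by simp) x (hsub _ hx)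
      have h3 := hQ q (by simp) y (hsub _ hy)
      rcases h1 with h1 | h1 <;> rcases h2 with h2 | h2 <;> rcases h3 with h3 | h3 <;>
        first
        | exact ⟨_, Or.inl rfl, Or.inl ⟨h1, h2⟩⟩
        | exact ⟨_, Or.inr rfl, Or.inl ⟨h1, h2⟩⟩
        | exact ⟨_, Or.inl rfl, Or.inr (Or.inl ⟨h1, h3⟩)⟩
        | exact ⟨_, Or.inr rfl, Or.inr (Or.inl ⟨h1, h3⟩)⟩
        | exact ⟨_, Or.inl rfl, Or.inr (Or.inr ⟨h2, h3⟩)⟩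
        | exact ⟨_, Or.inr rfl, Or.inr (Or.inr ⟨h2, h3⟩)⟩
    obtain ⟨p, hp, hcase⟩ := key
    have hrp : r ≠ p := by
      rcases hp with rfl | rfl <;> intro h <;> simp [h] at hnd3
    have hpold : p ∉ x :: A ++ y :: B := hnew p (by rcases hp with rfl | rfl <;> simp)
    have hrold : r ∉ x :: A ++ y :: B := hnew r (by simp)
    have hpQ : p ∈ unpair (q :: Q) := by
      rcases hp with rfl | rfl <;> simp
    have hnd'' : (r :: p :: (x :: A ++ y :: B)).Nodup := by
      refine List.nodup_cons.2 ⟨?_, List.nodup_cons.2 ⟨hpold, hAB⟩⟩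
      rw [List.mem_cons, not_or]
      exact ⟨hrp, hrold⟩
    have hpadj : ∃ r' ∈ a :: b :: r :: rs, G.Adj p r' := by
      rcases hcase with h | h | h
      exacts [⟨r, by simp, h.1⟩, ⟨r, by simp, h.1⟩, ⟨x, hsub _ hx, h.1⟩]
    have hall : ∀ v ∈ r :: p :: (x :: A ++ y :: B), v ∈ a :: b :: r :: rs ∨
        (v ∈ unpair (q :: Q) ∧ ∃ r' ∈ a :: b :: r :: rs, G.Adj v r') := by
      intro v hv
      rcases List.mem_cons.1 hv with rfl | hv
      · exact Or.inl (by simp)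
      rcases List.mem_cons.1 hv with rfl | hv
      · exact Or.inr ⟨hpQ, hpadj⟩
      · exact hmem' v hv
    rcases hcase with h | h | h
    · refine ⟨r, p :: x :: A, y, B, b', ?_, hyb, by simp, hsub _ hy, hsub _ hb', ?_, hB, hnd'', ?_,
        hall⟩
      · simpa using hxa
      · exact List.isChain_cons_cons.2 ⟨h.1.symm, List.isChain_cons_cons.2 ⟨h.2, hA⟩⟩
      · simp at hlen ⊢; omega
    · have hpm : (x :: A ++ r :: p :: y :: B).Perm (r :: p :: (x :: A ++ y :: B)) :=
        List.perm_middle.trans (List.Perm.cons _ List.perm_middle)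
      refine ⟨x, A, r, p :: y :: B, b', hxa, ?_, hsub _ hx, by simp, hsub _ hb', hA, ?_,
        hpm.nodup_iff.2 hnd'', ?_, fun v hv => hall v (hpm.mem_iff.1 hv)⟩
      · simpa using hyb
      · exact List.isChain_cons_cons.2 ⟨h.1.symm, List.isChain_cons_cons.2 ⟨h.2, hB⟩⟩
      · simp at hlen ⊢; omega
    · -- merge the two paths through `p`, and let `r` start a new one
      obtain ⟨D, hD⟩ : ∃ D, (y :: B).reverse ++ p :: x :: A = b' :: D := by
        have : ((y :: B).reverse ++ p :: x :: A).head? = some b' := by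
          rw [List.head?_append_of_ne_nil _ (by simp), List.head?_reverse, hyb]
        exact ⟨_, (List.eq_cons_of_mem_head? this)⟩
      have hpm : (b' :: D ++ [r]).Perm (r :: p :: (x :: A ++ y :: B)) := by
        rw [← hD]
        refine List.perm_append_comm.trans ?_
        refine List.Perm.cons r (List.perm_middle.trans (List.Perm.cons _ ?_))
        exact List.perm_append_comm.trans ((List.reverse_perm _).append_left _)
      refine ⟨b', D, r, [], r, ?_, by simp, hsub _ hb', by simp, by simp, ?_, by simp,
        hpm.nodup_iff.2 hnd'', ?_, fun v hv => hall v (hpm.mem_iff.1 hv)⟩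
      · rw [← hD, List.getLast?_append_of_ne_nil _ (by simp)]
        simpa using hxa
      · rw [← hD]
        refine (isChain_adj_reverse hB).append (hA.cons (by simpa using h.1)) ?_
        simpa using h.2.symm
      · rw [hpm.length_eq]
        simp at hlen ⊢; omega

/-- If every vertex of `R = a :: rs` is adjacent to `c` and to an entry of every pair in `Q`, and
`Q` has at least `|R| - 1` pairs, then there is a path with `2 * |R|` vertices that starts at `a`
and passes through all of `R`. Its other vertices have a neighbour in `R`. -/
theorem exists_alternating_path (G : SimpleGraph V) (a c : V) (rs : List V) (Q : List (V × V))
    (hlen : rs.length ≤ Q.length) (hnd : (a :: rs ++ c :: unpair Q).Nodup)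
    (hc : ∀ r ∈ a :: rs, G.Adj c r)
    (hQ : ∀ q ∈ Q, ∀ r ∈ a :: rs, G.Adj q.1 r ∨ G.Adj q.2 r) :
    ∃ L, (a :: L).IsChain G.Adj ∧ (a :: L).Nodup ∧ (a :: L).length = 2 * rs.length + 2 ∧
      ∀ v ∈ a :: L, v ∈ a :: rs ∨ (v ∈ c :: unpair Q ∧ ∃ r ∈ a :: rs, G.Adj v r) := by
  rcases rs with _ | ⟨b, rs⟩
  · refine ⟨[c], ?_, ?_, by simp, ?_⟩
    · simpa using (hc a (by simp)).symm
    · simp at hnd ⊢; tauto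
    · simp [hc a (by simp)]
  rcases Q with _ | ⟨q, Q⟩
  · simp at hlen
  have hperm : (a :: b :: rs ++ c :: unpair (q :: Q)).Perm
      ([c, q.1, q.2] ++ (a :: b :: rs ++ unpair Q)) := by
    classical
    rw [List.perm_iff_count]
    intro v
    simp [List.count_cons]
    ring
  rw [hperm.nodup_iff, List.nodup_append'] at hnd
  obtain ⟨hnd3, hnd', hdisj⟩ := hnd
  obtain ⟨x, A, y, B, b', hxa, hyb, hx, hy, hb', hA, hB, hAB, hlen', hmem⟩ :=
    exists_two_paths G a b rs Q (by simpa using hlen) hnd'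
      (fun q' hq' r' hr' => hQ q' (List.mem_cons_of_mem _ hq') r' hr')
  have hold : ∀ v ∈ x :: A ++ y :: B, v ∈ a :: b :: rs ++ unpair Q := by
    intro v hv
    rcases hmem v hv with h | h
    · exact List.mem_append_left _ h
    · exact List.mem_append_right _ h.1
  have hnew : ∀ z ∈ [c, q.1, q.2], z ∉ x :: A ++ y :: B := fun z hz hz' => hdisj hz (hold z hz')
  obtain ⟨p, hp, hpb⟩ : ∃ p, (p = q.1 ∨ p = q.2) ∧ G.Adj p b' := by
    rcases hQ q (by simp) b' hb' with h | h
    exacts [⟨_, Or.inl rfl, h⟩, ⟨_, Or.inr rfl, h⟩]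
  obtain ⟨D, hD⟩ : ∃ D, (x :: A).reverse ++ c :: (y :: B ++ [p]) = a :: D := by
    have : ((x :: A).reverse ++ c :: (y :: B ++ [p])).head? = some a := by
      rw [List.head?_append_of_ne_nil _ (by simp), List.head?_reverse, hxa]
    exact ⟨_, (List.eq_cons_of_mem_head? this)⟩
  have hpm : (a :: D).Perm (p :: c :: (x :: A ++ y :: B)) := by
    rw [← hD]
    refine List.perm_middle.trans ?_
    refine (List.Perm.cons c ?_).trans (List.Perm.swap _ _ _)
    rw [← List.append_assoc]
    exact List.perm_append_comm.trans (List.Perm.cons p ((List.reverse_perm _).append_right _))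
  refine ⟨D, ?_, ?_, ?_, ?_⟩
  · rw [← hD]
    refine (isChain_adj_reverse hA).append (List.IsChain.cons (hB.append (by simp) ?_) ?_) ?_
    · intro u hu w hw
      rw [hyb] at hu
      simp at hu hw
      subst hu hw
      exact hpb.symm
    · simpa using hc y hy
    · simpa using (hc x hx).symm
  · rw [hpm.nodup_iff]
    refine List.nodup_cons.2 ⟨?_, List.nodup_cons.2 ⟨hnew c (by simp), hAB⟩⟩
    rw [List.mem_cons, not_or]
    refine ⟨?_, hnew p (by rcases hp with rfl | rfl <;> simp)⟩
    rcases hp with rfl | rfl <;> intro h <;> simp [h] at hnd3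
  · rw [hpm.length_eq]
    simp at hlen' ⊢; omega
  · intro v hv
    rcases List.mem_cons.1 (hpm.mem_iff.1 hv) with rfl | hv
    · exact Or.inr ⟨by rcases hp with rfl | rfl <;> simp, b', hb', hpb⟩
    rcases List.mem_cons.1 hv with rfl | hv
    · exact Or.inr ⟨by simp, x, hx, hc x hx⟩
    rcases hmem v hv with h | ⟨h, h'⟩
    · exact Or.inl h
    · refine Or.inr ⟨List.mem_cons_of_mem _ ?_, h'⟩
      rw [unpair, List.flatMap_cons]
      exact List.mem_append_right _ h

end Paths

/-! ### Longest paths in a graph and paths in its complement -/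

section Longest

variable {V : Type*}

/-- If `P` is a longest path in one of two graphs that together cover all pairs of vertices, then
a vertex outside `P` is adjacent in the other graph to one of any two consecutive vertices
of `P`. -/
theorem IsLongestPathIn.isChain_adj_or_adj {G H : SimpleGraph V}
    (hGH : ∀ a b, a ≠ b → G.Adj a b ∨ H.Adj a b) {X : Finset V} {P : List V}
    (h : IsLongestPathIn H X P) {R : Finset V} (hR : ∀ r ∈ R, r ∈ X ∧ r ∉ P) :
    P.IsChain fun a b => ∀ r ∈ R, G.Adj a r ∨ G.Adj b r := by
  rw [List.isChain_iff_getElem]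
  intro i hi r hr
  obtain ⟨hrX, hrP⟩ := hR r hr
  by_contra hcon
  rw [not_or] at hcon
  have hne : ∀ v ∈ P, v ≠ r := fun v hv e => hrP (e ▸ hv)
  have h' : IsLongestPathIn H X (P.take (i + 1) ++ P.drop (i + 1)) := by
    rwa [List.take_append_drop]
  refine h'.not_insert hrX (by rwa [List.take_append_drop]) ?_ ?_
  · intro a ha
    have : a = P[i] := by
      rw [List.getLast?_take] at ha
      rw [if_neg (by omega), Nat.add_sub_cancel, List.getElem?_eq_getElem (by omega)] at ha
      simpa using ha.symm
    subst this
    exact (hGH _ r (hne _ (by simp))).resolve_left hcon.1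
  · intro c hc
    rw [List.head?_drop, List.getElem?_eq_getElem hi] at hc
    have : c = P[i + 1] := by simpa using hc.symm
    subst this
    exact ((hGH _ r (hne _ (by simp))).resolve_left hcon.2).symm

theorem IsLongestPathIn.head_adj {G H : SimpleGraph V}
    (hGH : ∀ a b, a ≠ b → G.Adj a b ∨ H.Adj a b) {X : Finset V} {P : List V}
    (h : IsLongestPathIn H X P) {r : V} (hr : r ∈ X) (hrP : r ∉ P) :
    ∀ c ∈ P.head?, G.Adj c r := by
  intro c hc
  refine (hGH c r ?_).resolve_right fun hcr => ?_
  · rintro rfl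
    exact hrP (List.mem_of_mem_head? hc)
  · refine IsLongestPathIn.not_insert (A := []) (C := P) h hr hrP (by simp) fun c' hc' => ?_
    rw [Option.mem_unique hc' hc]
    exact hcr.symm

theorem IsLongestPathIn.getLast_adj {G H : SimpleGraph V}
    (hGH : ∀ a b, a ≠ b → G.Adj a b ∨ H.Adj a b) {X : Finset V} {P : List V}
    (h : IsLongestPathIn H X P) {r : V} (hr : r ∈ X) (hrP : r ∉ P) :
    ∀ c ∈ P.getLast?, G.Adj c r := by
  intro c hc
  refine (hGH c r ?_).resolve_right fun hcr => ?_
  · rintro rfl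
    exact hrP (List.mem_of_mem_getLast? hc)
  · refine IsLongestPathIn.not_insert (A := P) (C := []) (by simpa using h) hr (by simpa using hrP)
      (fun c' hc' => ?_) (by simp)
    rwa [Option.mem_unique hc' hc]

/-- `exists_alternating_path` for a finite set `R` of vertices of `X`. -/
theorem exists_alternating_path_of_finset (G : SimpleGraph V) {X R : Finset V} {P : List V}
    (hPX : ∀ v ∈ P, v ∈ X) (hR : ∀ r ∈ R, r ∈ X ∧ r ∉ P) {a c : V} (ha : a ∈ R)
    {Q : List (V × V)} (hQP : (c :: unpair Q) ⊆ P) (hnd : (c :: unpair Q).Nodup)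
    (hcard : R.card ≤ Q.length + 1) (hc : ∀ r ∈ R, G.Adj c r)
    (hQ : ∀ q ∈ Q, ∀ r ∈ R, G.Adj q.1 r ∨ G.Adj q.2 r) :
    ∃ L, IsPathIn G X (a :: L) ∧ (a :: L).length = 2 * R.card ∧
      ∀ v ∈ a :: L, v ∈ R ∨ (v ∈ c :: unpair Q ∧ ∃ r ∈ R, G.Adj v r) := by
  classical
  have hmem : ∀ v, v ∈ a :: (R.erase a).toList ↔ v ∈ R := by
    intro v
    by_cases hv : v = a <;> simp [hv, ha]
  have hlen : (R.erase a).toList.length + 1 = R.card := by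
    rw [Finset.length_toList, Finset.card_erase_add_one ha]
  obtain ⟨L, h1, h2, h3, h4⟩ := exists_alternating_path G a c (R.erase a).toList Q (by omega)
    (by
      rw [List.nodup_append']
      refine ⟨List.nodup_cons.2 ⟨by simp, Finset.nodup_toList _⟩, hnd, ?_⟩
      intro v hv hv'
      exact (hR v ((hmem v).1 hv)).2 (hQP hv'))
    (fun r hr => hc r ((hmem r).1 hr)) (fun q hq r hr => hQ q hq r ((hmem r).1 hr))
  simp only [hmem] at h4
  refine ⟨L, ⟨h2, h1, fun v hv => ?_⟩, by omega, h4⟩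
  rcases h4 v hv with h | h
  · exact (hR v h).1
  · exact hPX v (hQP h.1)

/-- If `P` is a longest path of `H` in `X` and `R` is a set of `s ≥ 1` vertices of `X` outside
`P`, where `2 * s ≤ |P| + 1`, then the other graph has a path on `2 * s` vertices. -/
theorem IsLongestPathIn.exists_path_even {G H : SimpleGraph V}
    (hGH : ∀ a b, a ≠ b → G.Adj a b ∨ H.Adj a b) {X : Finset V} {P : List V}
    (h : IsLongestPathIn H X P) {R : Finset V} (hR : ∀ r ∈ R, r ∈ X ∧ r ∉ P)
    (hs : 1 ≤ R.card) (hk : 2 * R.card ≤ P.length + 1) :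
    ∃ L, IsPathIn G X L ∧ L.length = 2 * R.card := by
  obtain ⟨a, ha⟩ := Finset.card_pos.1 hs
  have hch := h.isChain_adj_or_adj hGH hR
  rcases P with _ | ⟨c, P⟩
  · rw [List.length_nil] at hk; omega
  have hsub := unpair_pairUp_sublist P
  obtain ⟨L, h1, h2, -⟩ := exists_alternating_path_of_finset G h.mem hR (c := c) (Q := pairUp P) ha
    (List.cons_subset_cons _ hsub.subset) (h.nodup.sublist (hsub.cons_cons c))
    (by rw [length_pairUp]; simp at hk; omega)
    (fun r hr => h.head_adj hGH (hR r hr).1 (hR r hr).2 c (by simp))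
    (fun q hq => rel_of_mem_pairUp hch.tail q hq)
  exact ⟨_, h1, h2⟩

/-- If `P` is a longest path of `H` in `X` and `R` is a set of `s ≥ 1` vertices of `X` outside `P`,
where `2 * s ≤ |P|`, then the other graph has a path on `2 * s + 1` vertices: an alternating path
through the outside vertices, extended by the last vertex of `P`. -/
theorem IsLongestPathIn.exists_path_odd {G H : SimpleGraph V}
    (hGH : ∀ a b, a ≠ b → G.Adj a b ∨ H.Adj a b) {X : Finset V} {P : List V}
    (h : IsLongestPathIn H X P) {R : Finset V} (hR : ∀ r ∈ R, r ∈ X ∧ r ∉ P)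
    (hs : 1 ≤ R.card) (hk : 2 * R.card ≤ P.length) :
    ∃ L, IsPathIn G X L ∧ L.length = 2 * R.card + 1 := by
  obtain ⟨a, ha⟩ := Finset.card_pos.1 hs
  have hch := h.isChain_adj_or_adj hGH hR
  rcases P with _ | ⟨c, P⟩
  · rw [List.length_nil] at hk; omega
  rcases List.eq_nil_or_concat' P with rfl | ⟨P, z, rfl⟩
  · simp at hk; omega
  have hsub := unpair_pairUp_sublist P
  have hz := h.getLast_adj hGH (hR a ha).1 (hR a ha).2 z (by
    rw [← List.cons_append, List.getLast?_append_of_ne_nil _ (by simp)]; simp)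
  have hnd : (c :: P).Nodup ∧ z ∉ c :: P := by
    have := h.nodup
    rw [← List.cons_append, List.nodup_append'] at this
    exact ⟨this.1, fun hz => this.2.2 hz (by simp)⟩
  obtain ⟨L, h1, h2, h3⟩ := exists_alternating_path_of_finset G h.mem hR (c := c) (Q := pairUp P) ha
    (List.cons_subset_cons _ (fun v hv => List.mem_append_left _ (hsub.subset hv)))
    (hnd.1.sublist (hsub.cons_cons c))
    (by rw [length_pairUp]; simp at hk; omega)
    (fun r hr => h.head_adj hGH (hR r hr).1 (hR r hr).2 c (by simp))
    (fun q hq => rel_of_mem_pairUp hch.tail.left_of_append q hq)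
  refine ⟨z :: a :: L, ⟨List.nodup_cons.2 ⟨fun hz' => ?_, h1.nodup⟩,
    List.isChain_cons_cons.2 ⟨hz, h1.chain⟩, fun v hv => ?_⟩, by simpa using h2⟩
  · rcases h3 z hz' with hzR | hzQ
    · exact (hR z hzR).2 (by simp)
    · exact hnd.2 ((hsub.cons_cons c).subset hzQ.1)
  · rcases List.mem_cons.1 hv with rfl | hv
    · exact h.mem v (by simp)
    · exact h1.mem v hv

/-- In a list of disjoint pairs, at most one pair contains `u`. -/
theorem length_le_length_filter_add_one {u : V} [DecidableEq V] : ∀ {Q : List (V × V)},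
    (unpair Q).Nodup →
      Q.length ≤ (Q.filter fun q => decide (q.1 ≠ u ∧ q.2 ≠ u)).length + 1
  | [], _ => by simp
  | q :: Q, h => by
    rw [unpair, List.flatMap_cons, List.nodup_append'] at h
    by_cases hq : q.1 ≠ u ∧ q.2 ≠ u
    · rw [List.filter_cons_of_pos (by simpa using hq)]
      simpa using length_le_length_filter_add_one (u := u) h.2.1
    · rw [List.filter_cons_of_neg (by simpa using hq), List.filter_eq_self.2]
      · simp
      intro q' hq'
      have hu : u ∈ [q.1, q.2] := by
        by_contra hu
        simp at hu
        exact hq ⟨Ne.symm hu.1, Ne.symm hu.2⟩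
      have huq' : u ∉ [q'.1, q'.2] := fun hu' => h.2.2 hu (List.mem_flatMap.2 ⟨q', hq', hu'⟩)
      simp at huq' ⊢
      exact ⟨Ne.symm huq'.1, Ne.symm huq'.2⟩

/-- With slightly more room in `P`, the alternating path through the set `R` of outside vertices
can start at a prescribed vertex of `R` and avoid a prescribed vertex of `P`. -/
theorem IsLongestPathIn.exists_path_avoiding {G H : SimpleGraph V}
    (hGH : ∀ a b, a ≠ b → G.Adj a b ∨ H.Adj a b) {X : Finset V} {P : List V}
    (h : IsLongestPathIn H X P) {R : Finset V} (hR : ∀ r ∈ R, r ∈ X ∧ r ∉ P) {a u : V}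
    (ha : a ∈ R) (hu : u ∉ R) (hk : 2 * R.card + 2 ≤ P.length) :
    ∃ L, IsPathIn G X (a :: L) ∧ (a :: L).length = 2 * R.card ∧
      ∀ v ∈ a :: L, v ≠ u ∧ (v ∈ R ∨ ∃ r ∈ R, G.Adj v r) := by
  classical
  have hch := h.isChain_adj_or_adj hGH hR
  rcases P with _ | ⟨c, P⟩
  · simp at hk
  rcases List.eq_nil_or_concat' P with rfl | ⟨P, z, rfl⟩
  · simp at hk
  have hsub := unpair_pairUp_sublist P
  have hnd := h.nodup
  rw [List.nodup_cons, List.nodup_append'] at hnd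
  set Q := (pairUp P).filter fun q => decide (q.1 ≠ u ∧ q.2 ≠ u) with hQ
  have hQlen := length_le_length_filter_add_one (u := u) (hnd.2.1.sublist hsub)
  rw [length_pairUp, ← hQ] at hQlen
  have hQsub : (unpair Q).Sublist P := (List.filter_sublist.flatMap _).trans hsub
  have huQ : u ∉ unpair Q := by
    simp only [hQ, List.mem_flatMap, not_exists, not_and, List.mem_filter]
    intro q hq
    simp at hq ⊢
    exact ⟨Ne.symm hq.2.1, Ne.symm hq.2.2⟩
  have hcz : c ≠ z := fun e => hnd.1 (by simp [e])
  -- at least one end of `P` differs from `u`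
  obtain ⟨d, hd, hdu, hdP⟩ : ∃ d, (d = c ∨ d = z) ∧ d ≠ u ∧ d ∉ P := by
    by_cases hcu : c = u
    · exact ⟨z, Or.inr rfl, fun e => hcz (hcu.trans e.symm), fun hz => hnd.2.2.2 hz (by simp)⟩
    · exact ⟨c, Or.inl rfl, hcu, fun hc => hnd.1 (by simp [hc])⟩
  obtain ⟨L, h1, h2, h3⟩ := exists_alternating_path_of_finset G h.mem hR (c := d) (Q := Q) ha
    (by
      intro v hv
      rcases List.mem_cons.1 hv with rfl | hv
      · rcases hd with rfl | rfl <;> simp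
      · have := hQsub.subset hv
        simp [this])
    (List.nodup_cons.2 ⟨fun hd' => hdP (hQsub.subset hd'), hnd.2.1.sublist hQsub⟩)
    (by simp at hk; omega)
    (fun r hr => by
      rcases hd with rfl | rfl
      · exact h.head_adj hGH (hR r hr).1 (hR r hr).2 d (by simp)
      · refine h.getLast_adj hGH (hR r hr).1 (hR r hr).2 d ?_
        rw [← List.cons_append, List.getLast?_append_of_ne_nil _ (by simp)]
        simp)
    (fun q hq => rel_of_mem_pairUp hch.tail.left_of_append q (List.mem_of_mem_filter hq))
  refine ⟨L, h1, h2, fun v hv => ⟨?_, (h3 v hv).imp id And.right⟩⟩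
  rintro rfl
  rcases h3 v hv with hv | ⟨hv, -⟩
  · exact hu hv
  · rcases List.mem_cons.1 hv with e | hv
    · exact hdu e.symm
    · exact huQ hv

theorem IsPathIn.card_filter_notMem [DecidableEq V] {G : SimpleGraph V} {X : Finset V}
    {P : List V} (h : IsPathIn G X P) : (X.filter (· ∉ P)).card + P.length = X.card := by
  have h1 : (X.filter (· ∈ P)) = P.toFinset := by
    ext v
    simpa using h.mem v
  rw [← List.toFinset_card_of_nodup h.nodup, ← h1, add_comm]
  exact Finset.card_filter_add_card_filter_not _

/-- One half of `exists_path_of_card`: the path in `H` is at least as long as any in `G`. -/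
theorem exists_path_of_card_aux {G H : SimpleGraph V}
    (hGH : ∀ a b, a ≠ b → G.Adj a b ∨ H.Adj a b) {X : Finset V} {P P' : List V}
    (h : IsLongestPathIn H X P) (h' : IsLongestPathIn G X P') (hle : P'.length ≤ P.length)
    (hX : X.Nonempty) {t : ℕ} (ht : 3 * t ≤ 2 * X.card) : t < P.length := by
  classical
  by_contra! hPt
  have hcard := h.card_filter_notMem
  have hP : 1 ≤ P.length := by
    obtain ⟨v, hv⟩ := hX
    exact h.length_le [v] ⟨by simp, by simp, by simpa using hv⟩
  obtain ⟨R, hRsub, hRcard⟩ := Finset.exists_subset_card_eq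
    (show (P.length + 1) / 2 ≤ (X.filter (· ∉ P)).card by omega)
  have hR : ∀ r ∈ R, r ∈ X ∧ r ∉ P := fun r hr => by simpa using hRsub hr
  rcases Nat.even_or_odd' P.length with ⟨k, hk | hk⟩
  · obtain ⟨L, hL, hlen⟩ := h.exists_path_odd hGH hR (by omega) (by omega)
    have := h'.length_le L hL
    omega
  · obtain ⟨L, hL, hlen⟩ := h.exists_path_even hGH hR (by omega) (by omega)
    have := h'.length_le L hL
    omega

/-- If `X` is nonempty and `2 * |X| ≥ 3 * t`, then one of two graphs that together cover all pairs
of vertices has a path with more than `t` vertices in `X`. This is the diagonal case of the theorem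
of Gerencsér and Gyárfás on the Ramsey number of two paths. -/
theorem exists_path_of_card {G H : SimpleGraph V}
    (hGH : ∀ a b, a ≠ b → G.Adj a b ∨ H.Adj a b) {X : Finset V} {P P' : List V}
    (h : IsLongestPathIn H X P) (h' : IsLongestPathIn G X P')
    (hX : X.Nonempty) {t : ℕ} (ht : 3 * t ≤ 2 * X.card) :
    t < P.length ∨ t < P'.length := by
  rcases le_total P'.length P.length with hle | hle
  · exact Or.inl (exists_path_of_card_aux hGH h h' hle hX ht)
  · exact Or.inr (exists_path_of_card_aux (fun a b hab => (hGH a b hab).symm) h' h hle hX ht)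

end Longest

/-! ### Low-degree vertices, connecting paths, and rotations -/

section Components

variable {V : Type*}

/-- If no entry satisfying `q` is directly followed by one satisfying `p`, then every pair of
consecutive entries contributes at most one to the two counts. -/
theorem countP_add_countP_dropLast_le {p q : V → Bool} : ∀ (a : V) (L : List V),
    (a :: L).IsChain (fun a b => ¬(q a ∧ p b)) →
      L.countP p + (a :: L).dropLast.countP q ≤ L.length
  | a, [], _ => by simp
  | a, b :: L, h => by
    rw [List.isChain_cons_cons] at h
    have := countP_add_countP_dropLast_le b L h.2
    rw [List.dropLast_cons_of_ne_nil (by simp), List.countP_cons, List.countP_cons,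
      List.length_cons]
    by_cases h1 : q a <;> by_cases h2 : p b <;> simp [h1, h2] at h ⊢ <;> omega

theorem card_le_countP [DecidableEq V] {S : Finset V} {L : List V} {p : V → Bool}
    (h : ∀ v ∈ S, v ∈ L ∧ p v) : S.card ≤ L.countP p := by
  rw [List.countP_eq_length_filter]
  refine le_trans (Finset.card_le_card fun v hv => ?_) (List.toFinset_card_le _)
  simpa using h v hv

/-- A closed path can be cut open at any of its vertices. -/
theorem exists_perm_cons_of_closed {G : SimpleGraph V} {L : List V} (h : L.IsChain G.Adj)
    (hcl : ∀ a ∈ L.getLast?, ∀ b ∈ L.head?, G.Adj a b) {c : V} (hc : c ∈ L) :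
    ∃ L', (c :: L').Perm L ∧ (c :: L').IsChain G.Adj := by
  obtain ⟨A, B, rfl⟩ := List.append_of_mem hc
  refine ⟨B ++ A, by simpa using List.perm_append_comm (l₁ := c :: B) (l₂ := A), ?_⟩
  rw [List.isChain_append] at h
  rw [← List.cons_append]
  refine h.2.1.append h.1 fun a ha b hb => hcl a ?_ b ?_
  · rwa [List.getLast?_append_of_ne_nil _ (by simp)]
  · rw [List.head?_append, hb]
    rfl

/-- A component with at least `n` vertices in a graph without paths on `n` vertices has a vertex of
degree at most `(n - 2) / 2`. Indeed, if both ends of a longest path had larger degree, Ore's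
argument would turn the path into a cycle, which could be opened and extended as the component is
connected. -/
theorem exists_two_mul_degree_add_two_le [Fintype V] [DecidableEq V] (G : SimpleGraph V)
    [DecidableRel G.Adj] {D : Finset V} {v₀ : V}
    (hD : ∀ v, v ∈ D ↔ G.Reachable v₀ v) {n : ℕ}
    (hlong : ∀ L, IsPathIn G Finset.univ L → L.length < n) (hcard : n ≤ D.card) :
    ∃ x ∈ D, 2 * (Finset.univ.filter (G.Adj x)).card + 2 ≤ n := by
  obtain ⟨P, hP⟩ := exists_isLongestPathIn G D
  have hPn := hlong P (hP.toIsPathIn.mono (Finset.subset_univ _))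
  have hclosed : ∀ {v w}, v ∈ D → G.Adj v w → w ∈ D := fun hv hvw =>
    (hD _).2 (((hD _).1 hv).trans hvw.reachable)
  rcases P with _ | ⟨x, P⟩
  · have := hP.length_le [v₀] ⟨by simp, by simp, by simp [hD]⟩
    simp at this
  obtain ⟨A, y, hAy⟩ := (List.eq_nil_or_concat' (x :: P)).resolve_left (by simp)
  have hxD : x ∈ D := hP.mem x (by simp)
  have hyD : y ∈ D := hP.mem y (by simp [hAy])
  have hx : ∀ v ∈ Finset.univ.filter (G.Adj x), v ∈ P ∧ decide (G.Adj x v) := by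
    intro v hv
    simp only [Finset.mem_filter, Finset.mem_univ, true_and] at hv
    refine ⟨?_, by simpa using hv⟩
    by_contra hvP
    refine IsLongestPathIn.not_insert (A := []) (C := x :: P) hP (hclosed hxD hv) ?_ (by simp) ?_
    · rw [List.nil_append, List.mem_cons, not_or]
      exact ⟨hv.ne', hvP⟩
    · simpa using hv.symm
  have hy : ∀ v ∈ Finset.univ.filter (G.Adj y), v ∈ A ∧ decide (G.Adj y v) := by
    intro v hv
    simp only [Finset.mem_filter, Finset.mem_univ, true_and] at hv
    refine ⟨?_, by simpa using hv⟩
    by_contra hvA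
    rw [hAy] at hP
    refine IsLongestPathIn.not_insert (A := A ++ [y]) (C := []) (by simpa using hP)
      (hclosed hyD hv) ?_ ?_ (by simp)
    · simp [hvA, hv.ne']
    · simpa using hv
  have hx' := card_le_countP hx
  have hy' := card_le_countP hy
  by_cases hch : (x :: P).IsChain fun a b => ¬(decide (G.Adj y a) ∧ decide (G.Adj x b))
  · have := countP_add_countP_dropLast_le (p := fun v => decide (G.Adj x v))
      (q := fun v => decide (G.Adj y v)) x P hch
    rw [hAy, List.dropLast_concat] at this
    rw [List.length_cons] at hPn
    rcases le_total (Finset.univ.filter (G.Adj x)).card (Finset.univ.filter (G.Adj y)).card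
      with h | h
    · exact ⟨x, hxD, by omega⟩
    · exact ⟨y, hyD, by omega⟩
  exfalso
  -- `y` is adjacent to `P[i]` and `x` to `P[i + 1]`
  obtain ⟨i, hi, hyx⟩ := List.exists_not_getElem_of_not_isChain hch
  rw [not_not, decide_eq_true_eq, decide_eq_true_eq] at hyx
  set B := (x :: P).take (i + 1) with hB
  set C := (x :: P).drop (i + 1) with hC
  have hBC : B ++ C = x :: P := List.take_append_drop _ _
  have hBlast : B.getLast? = some (x :: P)[i] := by
    rw [hB, List.getLast?_take, if_neg (by omega), Nat.add_sub_cancel,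
      List.getElem?_eq_getElem (by omega)]
    rfl
  have hChead : C.head? = some (x :: P)[i + 1] := by
    rw [hC, List.head?_drop, List.getElem?_eq_getElem hi]
  have hBhead : B.head? = some x := by simp [hB]
  have hC0 : C ≠ [] := by rintro e; simp [e] at hChead
  have hB0 : B ≠ [] := by rintro e; simp [e] at hBhead
  have hClast : C.getLast? = some y := by
    have := congrArg List.getLast? (hBC.trans hAy)
    rwa [List.getLast?_append_of_ne_nil _ hC0, List.getLast?_append_of_ne_nil _ (by simp),
      List.getLast?_singleton] at this
  have hchain := hP.chain
  rw [← hBC, List.isChain_append] at hchain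
  have hperm : (C ++ B.reverse).Perm (x :: P) := by
    rw [← hBC]
    exact List.perm_append_comm.trans ((List.reverse_perm _).append_right _)
  have hcyc : (C ++ B.reverse).IsChain G.Adj := by
    refine hchain.2.1.append (isChain_adj_reverse hchain.1) fun a ha b hb => ?_
    rw [hClast] at ha
    rw [List.head?_reverse, hBlast] at hb
    simp only [Option.mem_def, Option.some.injEq] at ha hb
    subst ha hb
    exact hyx.1
  have hcl : ∀ a ∈ (C ++ B.reverse).getLast?, ∀ b ∈ (C ++ B.reverse).head?, G.Adj a b := by
    intro a ha b hb
    rw [List.getLast?_append_of_ne_nil _ (by simpa using hB0), List.getLast?_reverse, hBhead] at ha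
    rw [List.head?_append_of_ne_nil _ hC0, hChead] at hb
    simp only [Option.mem_def, Option.some.injEq] at ha hb
    subst ha hb
    exact hyx.2
  obtain ⟨w, hwD, hwP⟩ : ∃ w ∈ D, w ∉ x :: P := by
    by_contra! hall
    have := Finset.card_le_card (show D ⊆ (x :: P).toFinset from fun w hw => by
      simpa using hall w hw)
    have := List.toFinset_card_le (x :: P)
    omega
  obtain ⟨p⟩ := ((hD x).1 hxD).symm.trans ((hD w).1 hwD)
  obtain ⟨d, -, hd1, hd2⟩ := p.exists_boundary_dart {v | v ∈ x :: P} (by simp) hwP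
  simp only [Set.mem_ofPred_eq] at hd1 hd2
  obtain ⟨L, hL, hLch⟩ := exists_perm_cons_of_closed hcyc hcl (hperm.mem_iff.2 hd1)
  have hLP := hL.trans hperm
  have := hP.length_le (d.snd :: d.fst :: L)
    ⟨List.nodup_cons.2 ⟨fun h => hd2 (hLP.mem_iff.1 h), hLP.nodup_iff.2 hP.nodup⟩,
      List.isChain_cons_cons.2 ⟨d.adj.symm, hLch⟩, fun v hv => by
        rcases List.mem_cons.1 hv with rfl | hv
        · exact hclosed (hP.mem _ hd1) d.adj
        · exact hP.mem v (hLP.mem_iff.1 hv)⟩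
  have := hLP.length_eq
  simp at *
  omega

/-- A path from `x` towards the set `R`, stopped right after its first vertex `u` with a neighbour
in `R`. -/
theorem exists_path_to_set {G : SimpleGraph V} {R : Finset V} {x r : V} (hxR : x ∉ R) (hr : r ∈ R)
    (hreach : G.Reachable x r) (hx : ∀ r ∈ R, ¬G.Adj x r) :
    ∃ l u a, l ≠ [] ∧ a ∈ R ∧ G.Adj u a ∧ (l ++ [u]).Nodup ∧ (l ++ [u]).IsChain G.Adj ∧
      (∀ v ∈ l ++ [u], v ∉ R) ∧ ∀ v ∈ l, ∀ r ∈ R, ¬G.Adj v r := by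
  classical
  obtain ⟨p, hp⟩ := hreach.exists_isPath
  have key : ∀ (L : List V) (x : V), (x :: L).IsChain G.Adj → x ∉ R → r ∈ x :: L →
      ∃ l u C, x :: L = l ++ u :: C ∧ (∃ a ∈ R, G.Adj u a) ∧
        (∀ v ∈ l ++ [u], v ∉ R) ∧ ∀ v ∈ l, ∀ r ∈ R, ¬G.Adj v r := by
    intro L
    induction L with
    | nil =>
      intro x _ hxR hrL
      simp at hrL
      exact absurd (hrL ▸ hr) hxR
    | cons b L ih =>
      intro x hch hxR hrL
      rw [List.isChain_cons_cons] at hch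
      by_cases hxa : ∃ a ∈ R, G.Adj x a
      · exact ⟨[], x, b :: L, rfl, hxa, by simpa using hxR, by simp⟩
      · push Not at hxa
        have hb : b ∉ R := fun hb => hxa b hb hch.1
        obtain ⟨l, u, C, h1, h2, h3, h4⟩ := ih b hch.2 hb
          ((List.mem_cons.1 hrL).resolve_left fun e => hxR (e ▸ hr))
        refine ⟨x :: l, u, C, by rw [h1]; rfl, h2, ?_, ?_⟩
        · intro v hv
          rcases List.mem_cons.1 hv with rfl | hv
          exacts [hxR, h3 v hv]
        · intro v hv
          rcases List.mem_cons.1 hv with rfl | hv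
          exacts [hxa, h4 v hv]
  have hsup := p.cons_tail_support.symm
  have hch := p.isChain_adj_support
  have hnd := hp.support_nodup
  have hend := p.end_mem_support
  rw [hsup] at hch hnd hend
  obtain ⟨l, u, C, h1, ⟨a, ha, hua⟩, h3, h4⟩ := key _ _ hch hxR hend
  rw [h1, List.append_cons] at hch hnd
  refine ⟨l, u, a, ?_, ha, hua, hnd.sublist (List.sublist_append_left _ _), hch.left_of_append,
    h3, h4⟩
  rintro rfl
  have : x = u := (List.cons.inj h1).1
  exact hx a ha (this ▸ hua)

/-- If every vertex of `u :: us` is adjacent to every vertex of `rs`, and the first list is longer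
by one, then there is a path from `u` alternating between the two lists and using all of them. -/
theorem exists_interleaving {G : SimpleGraph V} : ∀ (us rs : List V) (u : V),
    us.length = rs.length → (∀ v ∈ u :: us, ∀ r ∈ rs, G.Adj v r) →
    ∃ L, (u :: L).IsChain G.Adj ∧ (u :: L).Perm (u :: us ++ rs)
  | [], [], u, _, _ => ⟨[], by simp, by simp⟩
  | [], r :: rs, u, h, _ => by simp at h
  | v :: us, [], u, h, _ => by simp at h
  | v :: us, r :: rs, u, h, hadj => by
    obtain ⟨L, h1, h2⟩ := exists_interleaving us rs v (by simpa using h)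
      fun w hw s hs => hadj w (List.mem_cons_of_mem _ hw) s (List.mem_cons_of_mem _ hs)
    refine ⟨r :: v :: L, List.isChain_cons_cons.2 ⟨hadj u (by simp) r (by simp),
      List.isChain_cons_cons.2 ⟨(hadj v (by simp) r (by simp)).symm, h1⟩⟩, ?_⟩
    refine ((h2.cons r).cons u).trans (List.Perm.cons u ?_)
    exact (List.perm_middle (l₁ := v :: us)).symm

/-- Let `P` be a longest path of `H` in `X`, let `R` be a nonempty set of vertices of `X`
outside `P`, and suppose that `P` has more than `|R|` vertices that are `H`-adjacent to all of `R`.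
The successors of these vertices on `P`, together with the first vertex of `P`, form a clique of `G`
completely `G`-adjacent to `R`, since otherwise `P` could be rotated and extended. So `G` has a path
on `2 * |R| + 2` vertices. -/
theorem IsLongestPathIn.exists_path_of_universal {G H : SimpleGraph V}
    (hGH : ∀ a b, a ≠ b → G.Adj a b ∨ H.Adj a b) {X : Finset V} {P : List V}
    (h : IsLongestPathIn H X P) {R : Finset V} (hR : ∀ r ∈ R, r ∈ X ∧ r ∉ P) (hRne : R.Nonempty)
    {T : Finset V} (hTP : ∀ t ∈ T, t ∈ P) (hTR : ∀ t ∈ T, ∀ r ∈ R, H.Adj t r)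
    (hT : R.card < T.card) :
    ∃ L, IsPathIn G X L ∧ L.length = 2 * R.card + 2 := by
  classical
  obtain ⟨r₀, hr₀⟩ := hRne
  obtain ⟨t₀, ht₀⟩ : T.Nonempty := Finset.card_pos.1 (by omega)
  set f : ℕ → V := fun i => P.getD i t₀ with hf
  have hfP : ∀ i (hi : i < P.length), f i = P[i] := fun i hi => by simp [hf, hi]
  have hk0 : 0 < P.length := List.length_pos_of_mem (hTP t₀ ht₀)
  have hsplit : ∀ i j, i ≤ j → P.take i ++ ((P.take j).drop i ++ P.drop j) = P := by
    intro i j hij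
    have : P.take i = (P.take j).take i := by rw [List.take_take, min_eq_left hij]
    rw [this, ← List.append_assoc, List.take_append_drop, List.take_append_drop]
  -- the rotation of `P` in terms of indices
  have hrot : ∀ i j, i < j → j < P.length → ∀ r ∈ R, (i = 0 ∨ H.Adj (f (i - 1)) r) →
      H.Adj r (f (j - 1)) → ¬H.Adj (f i) (f j) := by
    intro i j hij hj r hr h1 h2 h3
    rw [hfP i (by omega), hfP j hj] at h3
    rw [hfP (j - 1) (by omega)] at h2
    rw [hfP (i - 1) (by omega)] at h1
    have hP := h
    rw [← hsplit i j hij.le] at hP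
    refine hP.not_rotate (hR r hr).1 (by rw [hsplit i j hij.le]; exact (hR r hr).2) ?_ ?_ ?_ ?_
    · intro e
      have := congrArg List.length e
      simp at this
      omega
    · intro a ha
      rw [List.getLast?_take] at ha
      split_ifs at ha with hi0
      · simp at ha
      · rw [List.getElem?_eq_getElem (by omega)] at ha
        have : P[i - 1] = a := by simpa using ha
        exact this ▸ h1.resolve_left hi0
    · intro b hb
      rw [List.getLast?_drop, if_neg (by simp; omega), List.getLast?_take, if_neg (by omega),
        List.getElem?_eq_getElem (by omega)] at hb
      have : P[j - 1] = b := by simpa using hb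
      exact this ▸ h2
    · intro b hb c hc
      rw [List.head?_drop, List.getElem?_take, if_pos hij, List.getElem?_eq_getElem (by omega)] at hb
      rw [List.head?_drop, List.getElem?_eq_getElem hj] at hc
      have e1 : P[i] = b := by simpa using hb
      have e2 : P[j] = c := by simpa using hc
      exact e1 ▸ e2 ▸ h3
  have hlast : ∀ i, i < P.length → f i ∈ T → i + 1 < P.length := by
    intro i hi hiT
    by_contra hi'
    refine IsLongestPathIn.not_insert (A := P) (C := []) (by simpa using h) (hR r₀ hr₀).1
      (by simpa using (hR r₀ hr₀).2) ?_ (by simp)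
    intro a ha
    rw [List.getLast?_eq_getElem?, List.getElem?_eq_getElem (by omega)] at ha
    have e1 : P[P.length - 1] = a := by simpa using ha
    have e2 : f i = a := by
      rw [← e1, hfP i hi]
      congr 1
      omega
    exact e2 ▸ hTR _ hiT r₀ hr₀
  set J := (Finset.range P.length).filter fun i => f i ∈ T with hJ
  set I := insert 0 (J.image (· + 1)) with hI
  have hJcard : T.card ≤ J.card := by
    refine le_trans (Finset.card_le_card fun t ht => ?_) (Finset.card_image_le (f := f))
    obtain ⟨i, hi, hit⟩ := List.getElem_of_mem (hTP t ht)
    rw [Finset.mem_image]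
    refine ⟨i, ?_, by rw [hfP i hi, hit]⟩
    simp only [hJ, Finset.mem_filter, Finset.mem_range]
    exact ⟨hi, by rwa [hfP i hi, hit]⟩
  have hIcard : R.card + 2 ≤ I.card := by
    rw [hI, Finset.card_insert_of_notMem (by simp),
      Finset.card_image_of_injective _ (add_left_injective 1)]
    omega
  have hImem : ∀ i ∈ I, i < P.length ∧ (i = 0 ∨ f (i - 1) ∈ T) := by
    intro i hi
    simp only [hI, hJ, Finset.mem_insert, Finset.mem_image, Finset.mem_filter,
      Finset.mem_range] at hi
    rcases hi with rfl | ⟨j, ⟨hj, hjT⟩, rfl⟩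
    · exact ⟨hk0, Or.inl rfl⟩
    · exact ⟨hlast j hj hjT, Or.inr (by simpa using hjT)⟩
  have hinj : ∀ i ∈ I, ∀ j ∈ I, f i = f j → i = j := by
    intro i hi j hj hij
    rw [hfP i (hImem i hi).1, hfP j (hImem j hj).1] at hij
    exact (h.nodup.getElem_inj_iff).1 hij
  have hclique : ∀ i ∈ I, ∀ j ∈ I, i < j → G.Adj (f i) (f j) := by
    intro i hi j hj hij
    refine (hGH _ _ fun e => hij.ne (hinj i hi j hj e)).resolve_right ?_
    refine hrot i j hij (hImem j hj).1 r₀ hr₀ ((hImem i hi).2.imp id fun hiT => hTR _ hiT r₀ hr₀) ?_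
    exact (hTR _ ((hImem j hj).2.resolve_left (by omega)) r₀ hr₀).symm
  have hcliqueR : ∀ i ∈ I, ∀ r ∈ R, G.Adj (f i) r := by
    intro i hi r hr
    have hiP := (hImem i hi).1
    have hfi := hfP i hiP
    rcases Nat.eq_zero_or_pos i with rfl | hi0
    · refine h.head_adj hGH (hR r hr).1 (hR r hr).2 _ ?_
      rw [List.head?_eq_getElem?, List.getElem?_eq_getElem hk0, hfi]
      rfl
    · have hiT := (hImem i hi).2.resolve_left hi0.ne'
      refine (hGH _ _ ?_).resolve_right fun hir => ?_
      · rintro rfl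
        exact (hR _ hr).2 (hfi ▸ List.getElem_mem _)
      · have hP := h
        rw [← List.take_append_drop i P] at hP
        refine hP.not_insert (hR r hr).1 (by rw [List.take_append_drop]; exact (hR r hr).2) ?_ ?_
        · intro a ha
          rw [List.getLast?_take, if_neg (by omega), List.getElem?_eq_getElem (by omega)] at ha
          have : f (i - 1) = a := by rw [hfP _ (by omega)]; simpa using ha
          exact this ▸ hTR _ hiT r hr
        · intro c hc
          rw [List.head?_drop, List.getElem?_eq_getElem (hImem i hi).1] at hc
          have : f i = c := by rw [hfi]; simpa using hc
          exact this ▸ hir.symm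
  obtain ⟨I', hI'sub, hI'card⟩ := Finset.exists_subset_card_eq hIcard
  have hlen : (I'.toList.map f).length = R.card + 2 := by simp [hI'card]
  have hnd : (I'.toList.map f).Nodup := by
    refine List.Nodup.map_on ?_ (Finset.nodup_toList _)
    intro i hi j hj hij
    rw [Finset.mem_toList] at hi hj
    exact hinj i (hI'sub hi) j (hI'sub hj) hij
  have hmem : ∀ v ∈ I'.toList.map f, ∃ i ∈ I, f i = v := by
    intro v hv
    obtain ⟨i, hi, rfl⟩ := List.mem_map.1 hv
    exact ⟨i, hI'sub (Finset.mem_toList.1 hi), rfl⟩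
  obtain ⟨u, v, us, hus⟩ : ∃ u v us, I'.toList.map f = u :: v :: us := by
    rcases hl : I'.toList.map f with _ | ⟨u, _ | ⟨v, us⟩⟩
    · simp [hl] at hlen
    · simp [hl] at hlen
    · exact ⟨u, v, us, rfl⟩
  rw [hus] at hlen hnd hmem
  have hUR : ∀ w ∈ u :: v :: us, ∀ r ∈ R, G.Adj w r := by
    intro w hw r hr
    obtain ⟨i, hi, rfl⟩ := hmem w hw
    exact hcliqueR i hi r hr
  have huv : G.Adj u v := by
    obtain ⟨i, hi, rfl⟩ := hmem u (by simp)
    obtain ⟨j, hj, rfl⟩ := hmem v (by simp)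
    rcases lt_trichotomy i j with hij | rfl | hij
    · exact hclique i hi j hj hij
    · simp at hnd
    · exact (hclique j hj i hi hij).symm
  obtain ⟨L, hL1, hL2⟩ := exists_interleaving us R.toList v (by simp at hlen ⊢; omega)
    fun w hw r hr => hUR w (List.mem_cons_of_mem _ hw) r (Finset.mem_toList.1 hr)
  have hperm : (u :: v :: L).Perm (u :: v :: us ++ R.toList) := hL2.cons u
  refine ⟨u :: v :: L, ⟨?_, List.isChain_cons_cons.2 ⟨huv, hL1⟩, ?_⟩, ?_⟩
  · rw [hperm.nodup_iff, List.nodup_append']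
    refine ⟨hnd, Finset.nodup_toList _, fun w hw hw' => ?_⟩
    exact (hUR w hw w (Finset.mem_toList.1 hw')).ne rfl
  · intro w hw
    rcases List.mem_append.1 (hperm.mem_iff.1 hw) with hw | hw
    · obtain ⟨i, hi, rfl⟩ := hmem w hw
      rw [hfP i (hImem i hi).1]
      exact h.mem _ (List.getElem_mem _)
    · exact (hR w (Finset.mem_toList.1 hw)).1
  · rw [hperm.length_eq]
    simp at hlen ⊢
    omega

end Components

/-! ### The upper bound -/

section UpperBound

variable {V : Type*}

theorem adj_or_compl_adj (G : SimpleGraph V) (a b : V) (hab : a ≠ b) : G.Adj a b ∨ Gᶜ.Adj a b := by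
  rw [compl_adj]
  tauto

/-- The upper bound when `G` has a component `D` with at least `n` vertices. A vertex `x` of `D` of
small degree has enough non-neighbours to apply the alternating paths above, except when `m` and `n`
are even and all inequalities are equalities; then the alternating path is one vertex too short, and
it is extended either by a path leading to it from `x`, or, if `x` lies in another component, by
means of `IsLongestPathIn.exists_path_of_universal`. -/
theorem exists_compl_path_of_large_component [Fintype V] [DecidableEq V] (G : SimpleGraph V)
    [DecidableRel G.Adj] {n m : ℕ} (hn : 2 ≤ n) (hm : n + 1 ≤ m) (hm' : m ≤ 2 * n - 1)
    (hV : Fintype.card V + 2 = m + n + m % 2)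
    (hlong : ∀ L, IsPathIn G Finset.univ L → L.length < n) {D : Finset V} {v₀ : V}
    (hD : ∀ v, v ∈ D ↔ G.Reachable v₀ v) (hcard : n ≤ D.card) :
    ∃ x P, IsPathIn Gᶜ (Finset.univ.filter (Gᶜ.Adj x)) P ∧ m ≤ P.length := by
  obtain ⟨x, hxD, hdeg⟩ := exists_two_mul_degree_add_two_le G hD hlong hcard
  set d := (Finset.univ.filter (G.Adj x)).card with hd
  set X := Finset.univ.filter (Gᶜ.Adj x) with hX
  have hXcard : d + X.card + 1 = Fintype.card V := by
    have h1 : Finset.univ = insert x (Finset.univ.filter (G.Adj x) ∪ X) := by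
      ext v
      simp only [hX, compl_adj, Finset.mem_univ, Finset.mem_insert, Finset.mem_union,
        Finset.mem_filter, true_and, true_iff]
      tauto
    have h2 : Disjoint (Finset.univ.filter (G.Adj x)) X := by
      rw [Finset.disjoint_filter]
      intro v _ h
      simp [h]
    rw [← Finset.card_univ, h1, Finset.card_insert_of_notMem (by simp [hX]),
      Finset.card_union_of_disjoint h2]
  have hGH := adj_or_compl_adj G
  obtain ⟨P, hP⟩ := exists_isLongestPathIn Gᶜ X
  obtain ⟨P', hP'⟩ := exists_isLongestPathIn G X
  have hup : ∀ L, IsPathIn G X L → L.length < n := fun L hL =>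
    hlong L (hL.mono (Finset.subset_univ _))
  refine ⟨x, P, hP.toIsPathIn, ?_⟩
  by_contra! hPm
  have hXne : X.Nonempty := Finset.card_pos.1 (by omega)
  have hnP : n ≤ P.length := by
    have := hup P' hP'.toIsPathIn
    have := exists_path_of_card hGH hP hP' hXne (t := n - 1) (by omega)
    omega
  have hRcard := hP.card_filter_notMem
  set R₀ := X.filter (· ∉ P) with hR₀
  have hR₀mem : ∀ r ∈ R₀, r ∈ X ∧ r ∉ P := fun r hr => by simpa [hR₀] using hr
  have hsmall : R₀.card < n / 2 := by
    by_contra! hle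
    obtain ⟨R, hRsub, hRc⟩ := Finset.exists_subset_card_eq hle
    obtain ⟨L, hL, hlen⟩ := hP.exists_path_odd hGH (R := R) (fun r hr => hR₀mem r (hRsub hr))
      (by omega) (by omega)
    have := hup L hL
    omega
  have hn2 : 2 * R₀.card + 2 = n := by omega
  have hPlen : 2 * R₀.card + 3 ≤ P.length := by omega
  have hs : 1 ≤ R₀.card := by omega
  have hd2 : 2 * d + 2 = n := by omega
  have hxX : x ∉ X := by simp [hX]
  by_cases hreach : ∃ r ∈ R₀, G.Reachable x r
  · obtain ⟨r, hr, hxr⟩ := hreach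
    obtain ⟨l, u, a, hl0, ha, hua, hlnd, hlch, hlR, hladj⟩ :=
      exists_path_to_set (fun h => hxX (hR₀mem x h).1) hr hxr fun r hr => by
        have := (hR₀mem r hr).1
        simp only [hX, Finset.mem_filter, compl_adj] at this
        exact this.2.2
    obtain ⟨L, hL1, hL2, hL3⟩ := hP.exists_path_avoiding hGH hR₀mem ha (hlR u (by simp)) (by omega)
    have hpath : IsPathIn G Finset.univ ((l ++ [u]) ++ a :: L) := by
      refine ⟨?_, ?_, by simp⟩
      · rw [List.nodup_append']
        refine ⟨hlnd, hL1.nodup, fun v hv hvL => ?_⟩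
        obtain ⟨hvu, hv'⟩ := hL3 v hvL
        rcases hv' with hvR | ⟨r', hr', hvr'⟩
        · exact hlR v hv hvR
        · rcases List.mem_append.1 hv with hv | hv
          · exact hladj v hv r' hr' hvr'
          · exact hvu (by simpa using hv)
      · refine hlch.append hL1.chain ?_
        simpa using hua
    have := hlong _ hpath
    have := List.length_pos_iff.2 hl0
    simp only [List.length_append, List.length_cons, List.length_nil] at *
    omega
  · push Not at hreach
    have hxreach : ∀ v ∈ D, G.Reachable x v := fun v hv =>
      ((hD x).1 hxD).symm.trans ((hD v).1 hv)
    set T := D.filter (· ∈ X) with hT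
    have hTcard : D.card ≤ T.card + d + 1 := by
      have : D ⊆ insert x (T ∪ Finset.univ.filter (G.Adj x)) := by
        intro v hv
        by_cases hvx : v = x
        · simp [hvx]
        · by_cases hxv : G.Adj x v
          · simp [hxv]
          · simp [hT, hX, hv, hxv, Ne.symm hvx]
      refine (Finset.card_le_card this).trans ((Finset.card_insert_le _ _).trans ?_)
      have := Finset.card_union_le T (Finset.univ.filter (G.Adj x))
      omega
    have hTmem : ∀ t ∈ T, t ∈ D ∧ t ∈ X := fun t ht => by simpa [hT] using ht
    obtain ⟨L, hL, hlen⟩ := hP.exists_path_of_universal hGH hR₀mem (Finset.card_pos.1 hs) (T := T)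
      (fun t ht => by
        by_contra htP
        refine hreach t ?_ (hxreach t (hTmem t ht).1)
        rw [hR₀, Finset.mem_filter]
        exact ⟨(hTmem t ht).2, htP⟩)
      (fun t ht r hr => by
        have htr := hxreach t (hTmem t ht).1
        rw [compl_adj]
        refine ⟨?_, fun h => hreach r hr (htr.trans h.reachable)⟩
        rintro rfl
        exact hreach t hr htr)
      (by omega)
    have := hup L hL
    omega

/-- The upper bound when all components of `G` have fewer than `n` vertices. There are at least
three components. For `x` in a smallest one, the complement of `G` restricted to the other
components contains a complete multipartite graph none of whose parts is too large. -/
theorem exists_compl_path_of_small_components [Fintype V] [DecidableEq V] (G : SimpleGraph V)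
    {n m : ℕ} (hn : 2 ≤ n) (hm : n + 1 ≤ m) (hm' : m ≤ 2 * n - 1)
    (hV : Fintype.card V + 2 = m + n + m % 2) (C : V → Finset V)
    (hC : ∀ v w, w ∈ C v ↔ G.Reachable v w) (hcard : ∀ v, (C v).card < n) :
    ∃ (x : V) (P : List V), (∀ v ∈ P, Gᶜ.Adj x v) ∧ P.Nodup ∧ P.IsChain Gᶜ.Adj ∧ m ≤ P.length := by
  have hGH := adj_or_compl_adj G
  have hne : (Finset.univ : Finset V).Nonempty := by
    rw [← Finset.card_pos, Finset.card_univ]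
    omega
  obtain ⟨x, -, hx⟩ := Finset.exists_min_image Finset.univ (fun v => (C v).card) hne
  set Y := (C x)ᶜ with hY
  have hYcard : (C x).card + Y.card = Fintype.card V := Finset.card_add_card_compl _
  have hYmem : ∀ v, v ∈ Y ↔ ¬G.Reachable x v := fun v => by rw [hY, Finset.mem_compl, hC]
  have hdisj : ∀ v w, ¬G.Reachable v w → Disjoint (C v) (C w) := by
    intro v w hvw
    rw [Finset.disjoint_left]
    intro z hz hz'
    exact hvw (((hC v z).1 hz).trans ((hC w z).1 hz').symm)
  -- besides `C x` and one more component there is a third one, not smaller than `C x`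
  have hthree : ∀ r ∈ Y, 2 * (C x).card + (C r).card ≤ Fintype.card V := by
    intro r hr
    obtain ⟨z, hz⟩ : ((C x ∪ C r)ᶜ).Nonempty := by
      rw [← Finset.card_pos, Finset.card_compl]
      have := Finset.card_union_le (C x) (C r)
      have := hcard x
      have := hcard r
      omega
    rw [Finset.mem_compl, Finset.mem_union, not_or, hC, hC] at hz
    have h1 := Finset.card_union_of_disjoint (hdisj x r ((hYmem r).1 hr))
    have h2 := Finset.card_union_of_disjoint (s := C x ∪ C r) (t := C z)
      (by
        rw [Finset.disjoint_union_left]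
        exact ⟨hdisj x z hz.1, hdisj r z hz.2⟩)
    have h3 := Finset.card_le_univ (C x ∪ C r ∪ C z)
    have h4 := hx z (Finset.mem_univ _)
    omega
  have hxn := hcard x
  have hYne : Y.Nonempty := Finset.card_pos.1 (by omega)
  have hYm : m ≤ Y.card := by
    obtain ⟨r, hr⟩ := hYne
    have := hthree r hr
    have := hx r (Finset.mem_univ _)
    rcases Nat.even_or_odd' m with ⟨k, hk | hk⟩ <;> omega
  obtain ⟨P, hP⟩ := exists_isLongestPathIn Gᶜ Y
  refine ⟨x, P, fun v hv => ?_, hP.nodup, hP.chain, ?_⟩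
  · have := (hYmem v).1 (hP.mem v hv)
    rw [compl_adj]
    refine ⟨?_, fun h => this h.reachable⟩
    rintro rfl
    exact this (Reachable.refl _)
  by_contra! hPm
  have hRcard := hP.card_filter_notMem
  obtain ⟨r, hr⟩ : (Y.filter (· ∉ P)).Nonempty := Finset.card_pos.1 (by omega)
  have hr' : r ∈ Y ∧ r ∉ P := by simpa using hr
  have hch := hP.isChain_adj_or_adj hGH (R := {r}) (by simpa using hr')
  have hhead := hP.head_adj hGH hr'.1 hr'.2
  have hlast := hP.getLast_adj hGH hr'.1 hr'.2
  -- vertices outside `C r` are never consecutive on `P` and never at its ends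
  have hYP : ∀ v ∈ Y \ C r, v ∈ P ∧ decide (v ∉ C r) := by
    intro v hv
    rw [Finset.mem_sdiff] at hv
    refine ⟨?_, by simpa using hv.2⟩
    by_contra hvP
    rcases P with _ | ⟨c, P⟩
    · have := hP.length_le [r] ⟨by simp, by simp, by simpa using hr'.1⟩
      simp at this
    · have h1 := hhead c (by simp)
      have h2 := hP.head_adj hGH hv.1 hvP c (by simp)
      exact hv.2 ((hC r v).2 (h1.symm.reachable.trans h2.reachable))
  have hcount := card_le_countP hYP
  have hsub : C r ⊆ Y := by
    intro v hv
    rw [hYmem]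
    exact fun h => (hYmem r).1 hr'.1 (h.trans ((hC r v).1 hv).symm)
  have hsd := Finset.card_sdiff_add_card_eq_card hsub
  have hmemC : ∀ v, G.Adj v r → v ∈ C r := fun v hv => (hC r v).2 hv.symm.reachable
  rcases P with _ | ⟨c, P⟩
  · have := hP.length_le [r] ⟨by simp, by simp, by simpa using hr'.1⟩
    simp at this
  obtain ⟨A, y, hAy⟩ := (List.eq_nil_or_concat' (c :: P)).resolve_left (by simp)
  have hc := hmemC c (hhead c (by simp))
  have hy := hmemC y (hlast y (by rw [hAy]; simp))
  have h1 := countP_add_countP_dropLast_le (p := fun v => decide (v ∉ C r))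
    (q := fun v => decide (v ∉ C r)) c P (hch.imp fun a b hab => by
      rcases hab r (by simp) with h | h
      · simp [hmemC a h]
      · simp [hmemC b h])
  have h2 : (c :: P).countP (fun v => decide (v ∉ C r)) =
      P.countP (fun v => decide (v ∉ C r)) := by
    rw [List.countP_cons]
    simp [hc]
  have h3 : (c :: P).countP (fun v => decide (v ∉ C r)) =
      A.countP (fun v => decide (v ∉ C r)) := by
    rw [hAy, List.countP_append]
    simp [hy]
  rw [hAy, List.dropLast_concat] at h1
  have := hthree r hr'.1
  have := hcard r
  rw [List.length_cons] at hPm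
  omega

end UpperBound

/-! ### Linear forests -/

section LinearForest

variable {V : Type*}

/-- A linear forest on `m` vertices is contained in the path on `m` vertices: put its components one
after the other. -/
theorem IsLinearForest.exists_bijection [Fintype V] {F : SimpleGraph V} (hF : IsLinearForest F) :
    ∃ f : V → Fin (Fintype.card V), Function.Injective f ∧
      ∀ u v, F.Adj u v → (f u : ℕ) + 1 = f v ∨ (f v : ℕ) + 1 = f u := by
  classical
  obtain ⟨t, ⟨σ⟩⟩ := Finite.exists_equiv_fin F.ConnectedComponent
  choose k e using fun i => hF.2 (σ.symm i)
  let φ : V → Σ i : Fin t, Fin (k i) := fun v =>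
    ⟨σ (F.connectedComponentMk v), (e (σ (F.connectedComponentMk v))).some
      ⟨v, (σ.symm_apply_apply _).symm⟩⟩
  have hφ : ∀ (i : Fin t) (v : V) (hv : F.connectedComponentMk v = σ.symm i),
      φ v = ⟨i, (e i).some ⟨v, hv⟩⟩ := by
    intro i v hv
    obtain rfl : σ (F.connectedComponentMk v) = i := by rw [hv, σ.apply_symm_apply]
    rfl
  have hbij : Function.Bijective φ := by
    constructor
    · intro u v huv
      have h1 : F.connectedComponentMk u = F.connectedComponentMk v :=
        σ.injective (congrArg Sigma.fst huv)
      rw [hφ (σ (F.connectedComponentMk v)) u (by simpa using h1),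
        hφ (σ (F.connectedComponentMk v)) v (by simp)] at huv
      have := eq_of_heq (Sigma.mk.inj huv).2
      exact congrArg Subtype.val ((e _).some.injective this)
    · rintro ⟨i, j⟩
      refine ⟨((e i).some.symm j).1, ?_⟩
      rw [hφ i _ ((e i).some.symm j).2]
      simp
  have hcard : ∑ i, k i = Fintype.card V := by
    rw [Fintype.card_of_bijective hbij, Fintype.card_sigma]
    simp
  refine ⟨fun v => Fin.cast hcard (finSigmaFinEquiv (φ v)), ?_, ?_⟩
  · exact (Fin.cast_injective hcard).comp (finSigmaFinEquiv.injective.comp hbij.1)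
  · intro u v huv
    have hv : F.connectedComponentMk v = σ.symm (σ (F.connectedComponentMk v)) := by simp
    have hu : F.connectedComponentMk u = σ.symm (σ (F.connectedComponentMk v)) := by
      rw [← hv]
      exact ConnectedComponent.sound huv.reachable
    have hadj : (pathGraph _).Adj ((e _).some ⟨u, hu⟩) ((e _).some ⟨v, hv⟩) :=
      (e _).some.map_rel_iff.2 huv
    rw [pathGraph_adj] at hadj
    simp only [Fin.val_cast, finSigmaFinEquiv_apply, hφ _ u hu, hφ _ v hv]
    omega

/-- A vertex cover of the path on `k` vertices has at least `⌊k / 2⌋` vertices. -/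
theorem le_two_mul_card_of_cover_pathGraph {k : ℕ} {S : Finset (Fin k)}
    (hS : ∀ i j, (pathGraph k).Adj i j → i ∈ S ∨ j ∈ S) : k ≤ 2 * S.card + k % 2 := by
  have h : ∀ i : Fin (k / 2), ∃ j ∈ S, (j : ℕ) / 2 = i := by
    intro i
    have hi := i.2
    rcases hS ⟨2 * i, by omega⟩ ⟨2 * i + 1, by omega⟩ (by simp [pathGraph_adj]) with h | h
    · exact ⟨_, h, by simp⟩
    · exact ⟨_, h, by simp; omega⟩
  choose f hf hfi using h
  have := Finset.card_le_card_of_injOn (s := Finset.univ) (t := S) f (by simpa using hf)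
    (fun i _ j _ hij => Fin.ext (by rw [← hfi i, ← hfi j, hij]))
  simp at this
  omega

/-- A vertex cover `S` of a linear forest `F` satisfies `|V(F)| ≤ 2 * |S| + o(F)`, where `o(F)` is
the number of odd components. -/
theorem IsLinearForest.card_le_of_cover [Fintype V] [DecidableEq V] {F : SimpleGraph V}
    (hF : IsLinearForest F) {S : Finset V} (hS : ∀ u v, F.Adj u v → u ∈ S ∨ v ∈ S) :
    Fintype.card V ≤ 2 * S.card + F.oddComponents.ncard := by
  classical
  have : Fintype F.ConnectedComponent := Fintype.ofFinite _
  have hcomp : ∀ c : F.ConnectedComponent, (Finset.univ.filter (F.connectedComponentMk · = c)).card ≤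
      2 * (S.filter (F.connectedComponentMk · = c)).card +
        if c ∈ F.oddComponents then 1 else 0 := by
    intro c
    obtain ⟨k, ⟨e⟩⟩ := hF.2 c
    have hk : (Finset.univ.filter (F.connectedComponentMk · = c)).card = k := by
      have h1 := Fintype.card_congr e.toEquiv
      rw [Fintype.card_fin] at h1
      rw [← h1, Fintype.card_subtype]
      rfl
    have hodd : c ∈ F.oddComponents ↔ k % 2 = 1 := by
      have : c.supp.ncard = k := by
        rw [← hk, ← Set.ncard_coe_finset]
        congr 1
        ext v
        simp [ConnectedComponent.mem_supp_iff]
      rw [Set.mem_ofPred_eq, this, Nat.odd_iff]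
    have hcov := le_two_mul_card_of_cover_pathGraph
      (S := Finset.univ.filter fun i => (e.symm i : V) ∈ S) (by
        intro i j hij
        simpa using hS _ _ (show F.Adj (e.symm i) (e.symm j) from e.symm.map_rel_iff.2 hij))
    have hle : (Finset.univ.filter fun i => (e.symm i : V) ∈ S).card ≤
        (S.filter (F.connectedComponentMk · = c)).card := by
      refine Finset.card_le_card_of_injOn (fun i => (e.symm i : V)) ?_ ?_
      · intro i hi
        have h : F.connectedComponentMk (e.symm i : V) = c := (e.symm i).2
        simp at hi
        simpa [hi] using h
      · intro i _ j _ hij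
        exact e.symm.injective (Subtype.ext hij)
    rw [hk]
    split_ifs with h
    · rw [hodd] at h
      omega
    · rw [hodd] at h
      omega
  have h1 : Fintype.card V = ∑ c, (Finset.univ.filter (F.connectedComponentMk · = c)).card := by
    rw [← Finset.card_univ]
    exact Finset.card_eq_sum_card_fiberwise (by simp)
  have h2 : S.card = ∑ c, (S.filter (F.connectedComponentMk · = c)).card :=
    Finset.card_eq_sum_card_fiberwise (t := Finset.univ) (by simp)
  have h3 : F.oddComponents.ncard = ∑ c, if c ∈ F.oddComponents then 1 else 0 := by
    rw [← Finset.card_filter, ← Set.ncard_coe_finset]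
    congr 1
    ext c
    simp
  rw [h1, h2, h3, Finset.mul_sum, ← Finset.sum_add_distrib]
  exact Finset.sum_le_sum fun c _ => hcomp c

end LinearForest

/-! ### Ramsey numbers -/

section Ramsey

theorem pathGraph_isContained {V : Type*} {G : SimpleGraph V} {X : Finset V} {L : List V} {n : ℕ}
    (hL : IsPathIn G X L) (hn : n ≤ L.length) : (pathGraph n).IsContained G := by
  have hch := List.isChain_iff_getElem.1 hL.chain
  refine ⟨⟨⟨fun i => L[(i : ℕ)], ?_⟩, ?_⟩⟩
  · intro i j hij
    rw [pathGraph_adj] at hij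
    rcases hij with h | h
    · have := hch i (by omega)
      simp only [h] at this
      exact this
    · have := hch j (by omega)
      simp only [h] at this
      exact this.symm
  · intro i j hij
    exact Fin.ext ((hL.nodup.getElem_inj_iff).1 hij)

theorem coneGraph_isContained {V W : Type*} [Fintype V] {F : SimpleGraph V} (hF : IsLinearForest F)
    {H : SimpleGraph W} {x : W} {P : List W} (hx : ∀ v ∈ P, H.Adj x v) (hnd : P.Nodup)
    (hP : P.IsChain H.Adj) (hcard : Fintype.card V ≤ P.length) : (coneGraph F).IsContained H := by
  obtain ⟨f, hf, hadj⟩ := hF.exists_bijection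
  have hch := List.isChain_iff_getElem.1 hP
  refine ⟨⟨⟨Sum.elim (fun _ => x) fun v => P[(f v : ℕ)], ?_⟩, ?_⟩⟩
  · rintro (u | u) (v | v) huv
    · exact absurd (Subsingleton.elim u v) huv
    · exact hx _ (List.getElem_mem _)
    · exact (hx _ (List.getElem_mem _)).symm
    · have h1 := (f u).2
      have h2 := (f v).2
      rcases hadj u v huv with h | h
      · have := hch (f u) (by omega)
        simp only [h] at this
        exact this
      · have := hch (f v) (by omega)
        simp only [h] at this
        exact this.symm
  · rintro (u | u) (v | v) huv
    · exact congrArg _ (Subsingleton.elim u v)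
    · exact absurd huv (hx _ (List.getElem_mem _)).ne
    · exact absurd huv.symm (hx _ (List.getElem_mem _)).ne
    · exact congrArg _ (hf (Fin.ext ((hnd.getElem_inj_iff).1 huv)))

theorem ramseyProperty_pathGraph_coneGraph {V : Type*} [Fintype V] {n m : ℕ} (hn : 2 ≤ n)
    (hm : n + 1 ≤ m) (hm' : m ≤ 2 * n - 1) {F : SimpleGraph V} (hF : IsLinearForest F)
    (hV : Fintype.card V = m) :
    RamseyProperty (pathGraph n) (coneGraph F) (m + n - 2 + m % 2) := by
  classical
  intro G
  by_cases hpath : ∃ L, IsPathIn G Finset.univ L ∧ n ≤ L.length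
  · obtain ⟨L, hL, hLn⟩ := hpath
    exact Or.inl (pathGraph_isContained hL hLn)
  push Not at hpath
  right
  have hcard : Fintype.card (Fin (m + n - 2 + m % 2)) + 2 = m + n + m % 2 := by
    rw [Fintype.card_fin]
    omega
  let C : Fin (m + n - 2 + m % 2) → Finset (Fin (m + n - 2 + m % 2)) :=
    fun v => Finset.univ.filter (G.Reachable v)
  have hC : ∀ v w, w ∈ C v ↔ G.Reachable v w := fun v w => by simp [C]
  by_cases hlarge : ∃ v, n ≤ (C v).card
  · obtain ⟨v, hv⟩ := hlarge
    obtain ⟨x, P, hP, hPm⟩ :=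
      exists_compl_path_of_large_component G hn hm hm' hcard hpath (hC v) hv
    exact coneGraph_isContained hF (fun w hw => by simpa using hP.mem w hw) hP.nodup hP.chain
      (hV ▸ hPm)
  · push Not at hlarge
    obtain ⟨x, P, hx, hnd, hch, hPm⟩ :=
      exists_compl_path_of_small_components G hn hm hm' hcard C hC hlarge
    exact coneGraph_isContained hF hx hnd hch (hV ▸ hPm)

/-- A colouring without the required graphs bounds the Ramsey number from below, since it restricts
to smaller vertex sets. -/
theorem card_lt_of_ramseyProperty {V W U : Type*} [Fintype U] {G₁ : SimpleGraph V}
    {G₂ : SimpleGraph W} (G : SimpleGraph U) (h₁ : ¬G₁.IsContained G) (h₂ : ¬G₂.IsContained Gᶜ)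
    {r : ℕ} (h : RamseyProperty G₁ G₂ r) : Fintype.card U < r := by
  by_contra! hr
  obtain ⟨f⟩ : Nonempty (Fin r ↪ U) := Function.Embedding.nonempty_of_card_le (by simpa using hr)
  rcases h (G.comap f) with hc | hc <;> obtain ⟨c⟩ := hc
  · exact h₁ ⟨⟨⟨fun v => f (c v), fun hvw => c.toHom.map_adj hvw⟩, f.injective.comp c.injective⟩⟩
  · refine h₂ ⟨⟨⟨fun v => f (c v), fun {v w} hvw => ?_⟩, f.injective.comp c.injective⟩⟩
    have := c.toHom.map_adj hvw
    rw [compl_adj] at this ⊢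
    exact ⟨fun e => this.1 (f.injective e), this.2⟩

/-- The disjoint union of complete graphs on `sz i` vertices. -/
def disjointCliques {ι : Type*} (sz : ι → ℕ) : SimpleGraph (Σ i, Fin (sz i)) where
  Adj x y := x.1 = y.1 ∧ x ≠ y
  symm := ⟨fun _ _ h => ⟨h.1.symm, h.2.symm⟩⟩
  loopless := ⟨fun _ h => h.2 rfl⟩

theorem card_filter_fst_eq {ι : Type*} [Fintype ι] [DecidableEq ι] (sz : ι → ℕ) (i : ι) :
    (Finset.univ.filter fun x : Σ i, Fin (sz i) => x.1 = i).card = sz i := by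
  rw [← Fintype.card_subtype, Fintype.card_congr (Equiv.sigmaSubtype i), Fintype.card_fin]

theorem not_pathGraph_isContained_disjointCliques {ι : Type*} [Fintype ι] [DecidableEq ι]
    {sz : ι → ℕ} {n : ℕ} (hn : 0 < n) (h : ∀ i, sz i < n) :
    ¬(pathGraph n).IsContained (disjointCliques sz) := by
  rintro ⟨c⟩
  obtain ⟨n, rfl⟩ := Nat.exists_eq_succ_of_ne_zero hn.ne'
  have hfst : ∀ j k, (pathGraph (n + 1)).Reachable j k → (c j).1 = (c k).1 := by
    rintro j k ⟨p⟩
    induction p with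
    | nil => rfl
    | cons hadj _ ih => exact (c.toHom.map_adj hadj).1.trans ih
  have := Finset.card_le_card_of_injOn (s := Finset.univ)
    (t := Finset.univ.filter fun x : Σ i, Fin (sz i) => x.1 = (c 0).1) c
    (fun j _ => by simpa using hfst j 0 ((pathGraph_connected n).preconnected j 0)) c.injective.injOn
  rw [card_filter_fst_eq, Finset.card_univ, Fintype.card_fin] at this
  have := h (c 0).1
  omega

/-- Three disjoint cliques with fewer than `n` vertices each give a lower bound for the Ramsey
number, if the remaining two cliques always either have fewer than `|V(F)|` vertices together, or
include one too small to contain a vertex cover of `F`. -/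
theorem sum_lt_of_ramseyProperty {V : Type*} [Fintype V] {F : SimpleGraph V}
    (hF : IsLinearForest F) {n : ℕ} {sz : Fin 3 → ℕ} (hsz : ∀ i, sz i < n)
    (h : ∀ i, 0 < sz i → ∑ j, sz j < Fintype.card V + sz i ∨
      ∃ j, j ≠ i ∧ 2 * sz j + F.oddComponents.ncard < Fintype.card V)
    {r : ℕ} (hr : RamseyProperty (pathGraph n) (coneGraph F) r) : ∑ i, sz i < r := by
  classical
  have hcard : Fintype.card (Σ i, Fin (sz i)) = ∑ i, sz i := by simp
  rw [← hcard]
  refine card_lt_of_ramseyProperty (disjointCliques sz)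
    (not_pathGraph_isContained_disjointCliques ((Nat.zero_le _).trans_lt (hsz 0)) hsz) ?_ hr
  rintro ⟨c⟩
  have hne : ∀ a b, (coneGraph F).Adj a b → (c a).1 ≠ (c b).1 := by
    intro a b hab he
    have := c.toHom.map_adj hab
    rw [compl_adj] at this
    exact this.2 ⟨he, this.1⟩
  have hinj : Function.Injective fun v => c (Sum.inr v) := c.injective.comp Sum.inr_injective
  set i := (c (Sum.inl 0)).1 with hi
  have hvi : ∀ v, (c (Sum.inr v)).1 ≠ i := fun v => hne _ _ trivial
  rcases h i (Nat.zero_lt_of_lt (c (Sum.inl 0)).2.2) with hlt | ⟨j, hji, hlt⟩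
  · have h1 := Finset.card_le_card_of_injOn (s := Finset.univ)
      (t := Finset.univ.filter fun x : Σ i, Fin (sz i) => ¬x.1 = i) (fun v => c (Sum.inr v))
      (fun v _ => by simpa using hvi v) hinj.injOn
    have h2 := Finset.card_filter_add_card_filter_not (s := Finset.univ)
      fun x : Σ i, Fin (sz i) => x.1 = i
    rw [card_filter_fst_eq, Finset.card_univ, hcard] at h2
    rw [Finset.card_univ] at h1
    omega
  · -- the vertices of `F` placed in the clique `j` form a vertex cover
    have h1 := hF.card_le_of_cover (S := Finset.univ.filter fun v => (c (Sum.inr v)).1 = j) (by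
      intro u v huv
      have key : ∀ i j a b : Fin 3, j ≠ i → a ≠ i → b ≠ i → a ≠ b → a = j ∨ b = j := by decide
      simpa using key i j _ _ hji (hvi u) (hvi v) (hne (Sum.inr u) (Sum.inr v) huv))
    have h2 := Finset.card_le_card_of_injOn
      (s := Finset.univ.filter fun v => (c (Sum.inr v)).1 = j)
      (t := Finset.univ.filter fun x : Σ i, Fin (sz i) => x.1 = j) (fun v => c (Sum.inr v))
      (fun v hv => by simpa using hv) hinj.injOn
    rw [card_filter_fst_eq] at h2
    omega

end Ramsey

theorem theorem4 {V : Type*} [Fintype V] (n m : ℕ) (hn : 2 ≤ n) (hm₁ : n + 1 ≤ m)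
    (hm₂ : m ≤ 2 * n - 1) (F : SimpleGraph V) (hF : IsLinearForest F) (hF_ne : F ≠ ⊥)
    (hV : Fintype.card V = m) :
    (∃ r : ℕ, RamseyProperty (SimpleGraph.pathGraph n) (coneGraph F) r) ∧
    (ramseyNumber (SimpleGraph.pathGraph n) (coneGraph F) : ℤ) ≤ m + n - 2 + ((m % 2 : ℕ) : ℤ) ∧
    max (2 * (n : ℤ) - 1) (max (⌈(3 * (m : ℚ)) / 2⌉ - 1) ((m : ℤ) + n - F.oddComponents.ncard - 2)) ≤
      (ramseyNumber (SimpleGraph.pathGraph n) (coneGraph F) : ℤ) := by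
  have hup := ramseyProperty_pathGraph_coneGraph hn hm₁ hm₂ hF hV
  have hmem : RamseyProperty (pathGraph n) (coneGraph F) (ramseyNumber (pathGraph n) (coneGraph F)) :=
    Nat.sInf_mem (s := {r | RamseyProperty (pathGraph n) (coneGraph F) r}) ⟨_, hup⟩
  have hle : ramseyNumber (pathGraph n) (coneGraph F) ≤ m + n - 2 + m % 2 := Nat.sInf_le hup
  refine ⟨⟨_, hup⟩, by omega, ?_⟩
  set R := ramseyNumber (pathGraph n) (coneGraph F)
  set o := F.oddComponents.ncard with ho
  refine max_le ?_ (max_le ?_ ?_)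
  · have := sum_lt_of_ramseyProperty hF (sz := ![n - 1, n - 1, 0])
      (by intro i; fin_cases i <;> simp <;> omega)
      (by
        intro i hi
        left
        rw [hV]
        fin_cases i <;> simp [Fin.sum_univ_three] at hi ⊢ <;> omega) hmem
    simp [Fin.sum_univ_three] at this
    omega
  · have := sum_lt_of_ramseyProperty hF (sz := ![m / 2, (m - 1) / 2, (m - 1) / 2])
      (by intro i; fin_cases i <;> simp <;> omega)
      (by
        intro i hi
        left
        rw [hV]
        fin_cases i <;> simp [Fin.sum_univ_three] at hi ⊢ <;> omega) hmem
    simp [Fin.sum_univ_three] at this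
    have h3 : 3 * m ≤ 2 * (R + 1) := by omega
    have : ⌈(3 * (m : ℚ)) / 2⌉ ≤ (R : ℤ) + 1 := by
      rw [Int.ceil_le, div_le_iff₀ (by norm_num)]
      have : (3 * m : ℚ) ≤ 2 * (R + 1) := by exact_mod_cast h3
      push_cast
      linarith
    linarith
  · have hpar : o % 2 = m % 2 := by
      have := F.odd_ncard_oddComponents
      rw [Nat.card_eq_fintype_card, hV, Nat.odd_iff, Nat.odd_iff] at this
      omega
    -- `(m - o) / 2` is the least possible size of a vertex cover of `F`; if it is `0`, then the
    -- truncated difference makes the last two cliques empty and the bound is still valid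
    have := sum_lt_of_ramseyProperty hF (sz := ![n - 1, (m - o) / 2 - 1, (m - o) / 2 - 1])
      (by intro i; fin_cases i <;> simp <;> omega)
      (by
        rw [hV, ← ho]
        intro i hi
        fin_cases i
        · left
          simp [Fin.sum_univ_three]
          omega
        · right
          refine ⟨2, by decide, ?_⟩
          simp at hi ⊢
          omega
        · right
          refine ⟨1, by decide, ?_⟩
          simp at hi ⊢
          omega) hmem
    simp [Fin.sum_univ_three] at this
    omega
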